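/- For an arithmetic function $f:\mathbb{N}\to\mathbb{C}$ and real $x\ge 1$ put $$S_f(x)=\sum_{n\le x}\frac{f([x/n])}{[x/n]},$$ where $[t]$ denotes the integral part of $t$. Let $f=\mathrm{id}\ast g$, that is, $f(n)=\sum_{d\mid n} d\,g(n/d)$ for $n\ge1$, where $g$ is a complex-valued arithmetic function that is bounded: $g(n)\ll 1$ for $n\ge 1$. Then the series $\sum_{m\ge1}\frac{f(m)}{m^2(m+1)}$ converges absolutely and $$S_f(x)=x\sum_{m\ge1}\frac{f(m)}{m^2(m+1)}+O\big(x^{1/3}\log x\big)\qquad(x\to\infty),$$ where the implied constant may depend on $f$. In particular, this holds when $f$ is any of Euler's totient function $\varphi$, the Dedekind function $\Psi(n)=n\prod_{p\mid n}(1+1/p)$, the sum-of-divisors function $\sigma(n)=\sum_{d\mid n}d$, and the alternating sum-of-divisors function $\beta(n)=\sum_{d\mid n}d\,(-1)^{\Omega(n/d)}$, where $\Omega(k)$ is the number of prime factors of $k$ counted with multiplicity. -/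

import Mathlib

open Filter Asymptotics

/-- The sum `S_f(x) = ∑_{n ≤ x} f([x/n]) / [x/n]`, for real `x`. -/
noncomputable def integralPartSum (f : ℕ → ℂ) (x : ℝ) : ℂ :=
  ∑ n ∈ Finset.Icc 1 ⌊x⌋₊, f ⌊x / (n : ℝ)⌋₊ / ((⌊x / (n : ℝ)⌋₊ : ℕ) : ℂ)

/-- The `m`-th term `f(m) / (m² (m + 1))` of the series giving the leading coefficient.
For `m = 0` the denominator vanishes and the term is `0`, so that summing over all natural
numbers is the same as summing over `m ≥ 1`. -/
noncomputable def mainTerm (f : ℕ → ℂ) (m : ℕ) : ℂ :=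
  f m / ((m : ℂ) ^ 2 * ((m : ℂ) + 1))

/-- The series `∑_{m ≥ 1} f(m) / (m² (m + 1))` converges absolutely, and
`S_f(x) = x ∑_{m ≥ 1} f(m) / (m² (m + 1)) + O(x^{1/3} log x)` as `x → ∞`. -/
def HasIntegralPartAsymptotic (f : ℕ → ℂ) : Prop :=
  Summable (mainTerm f) ∧
    (fun x : ℝ => integralPartSum f x - (x : ℂ) * ∑' m : ℕ, mainTerm f m)
      =O[atTop] (fun x : ℝ => x ^ ((1 : ℝ) / 3) * Real.log x)

/-- The Dedekind function `Ψ(n) = n ∏_{p ∣ n} (1 + 1/p)`. -/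
noncomputable def dedekindPsi (n : ℕ) : ℂ :=
  (n : ℂ) * ∏ p ∈ n.primeFactors, (1 + 1 / (p : ℂ))

/-- The alternating sum-of-divisors function `β(n) = ∑_{d ∣ n} d (-1)^{Ω(n/d)}`. -/
noncomputable def alternatingSigma (n : ℕ) : ℂ :=
  ∑ d ∈ n.divisors, (d : ℂ) * (-1 : ℂ) ^ (ArithmeticFunction.cardFactors (n / d))

/-! Since f(m)/m = ∑_{d ∣ m} g(d)/d, interchanging sums with X = ⌊x⌋ turns S_f(x) into the sum over
d ≤ X of g(d)/d times the number of n ≤ X with d ∣ ⌊X/n⌋. That number is X times `dvdDivDensity d`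
with error O((X/d)^{1/3} log X + X^{1/3}) (`abs_countDvdDiv_sub_le_pow`). With the weight 1/d both
errors add up to O(X^{1/3} log X): the first because ∑ d^{-4/3} converges, the second because ∑_{d ≤
X} 1/d ≪ log X. The densities recombine into the leading coefficient by regrouping an absolutely
convergent double series over m = de.

The count is split by the size of ⌊X/n⌋ relative to dK. The n with a given small value de fill an
interval; for large values n ≤ X/(dK), and divisibility by d is a difference of two floors. Both
parts become sums of ψ(t) = {t} - 1/2 at points (X/d)/(n + 1 + s) - c (`countDvdDiv_eq_sawtooth`).

To bound such sums, ψ is squeezed, up to O(1/H), between difference quotients with step 1/H of a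
periodic primitive whose Fourier series converges absolutely. Each frequency is an exponential sum,
handled by the second derivative test, which rests on the Kusmin–Landau inequality. Dyadic blocks
then give w log X + (N/w)^{3/2} with w = (X/d)^{1/3} for N terms, and K is chosen so that the last
term is at most X^{1/3}, or the sum is so short that the trivial bound suffices. -/

/-! ### The Kusmin–Landau inequality -/

/-- The additive character `t ↦ e^{2πit}` with complex values. -/
noncomputable def expTwoPiI (t : ℝ) : ℂ := Complex.exp ((2 * Real.pi * t : ℝ) * Complex.I)

theorem norm_expTwoPiI (t : ℝ) : ‖expTwoPiI t‖ = 1 := Complex.norm_exp_ofReal_mul_I _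

theorem expTwoPiI_add (s t : ℝ) : expTwoPiI (s + t) = expTwoPiI s * expTwoPiI t := by
  rw [expTwoPiI, expTwoPiI, expTwoPiI, ← Complex.exp_add]
  congr 1; push_cast; ring

theorem expTwoPiI_intCast (k : ℤ) : expTwoPiI k = 1 := by
  rw [expTwoPiI, Complex.exp_eq_one_iff]
  exact ⟨k, by push_cast; ring⟩

/-- The inverse of `e^{2πit} - 1`, written with a cotangent. -/
noncomputable def cotKernel (t : ℝ) : ℂ :=
  -1 / 2 - Complex.I / 2 * (Real.cos (Real.pi * t) / Real.sin (Real.pi * t) : ℝ)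

theorem cotKernel_mul (t : ℝ) (h : Real.sin (Real.pi * t) ≠ 0) :
    cotKernel t * (expTwoPiI t - 1) = 1 := by
  have h1 : expTwoPiI t =
      ((Real.cos (Real.pi * t) : ℝ) + (Real.sin (Real.pi * t) : ℝ) * Complex.I) ^ 2 := by
    rw [Complex.ofReal_cos, Complex.ofReal_sin, ← Complex.exp_mul_I, ← Complex.exp_nat_mul,
      expTwoPiI]
    congr 1; push_cast; ring
  have h2 : ((Real.cos (Real.pi * t) : ℝ) : ℂ) ^ 2 = 1 - ((Real.sin (Real.pi * t) : ℝ) : ℂ) ^ 2 := by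
    exact_mod_cast Real.cos_sq' (Real.pi * t)
  rw [h1, cotKernel]
  have h' : ((Real.sin (Real.pi * t) : ℝ) : ℂ) ≠ 0 := by exact_mod_cast h
  push_cast only [Complex.ofReal_div]
  generalize ((Real.sin (Real.pi * t) : ℝ) : ℂ) = s at *
  generalize ((Real.cos (Real.pi * t) : ℝ) : ℂ) = c at *
  have hI := Complex.I_sq
  field_simp
  linear_combination (-s ^ 3 - 2 * c ^ 2 * s - c * s ^ 2 * Complex.I) * hI + (s - Complex.I * c) * h2

theorem sin_pi_mul_pos {t : ℝ} (h0 : 0 < t) (h1 : t < 1) : 0 < Real.sin (Real.pi * t) :=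
  Real.sin_pos_of_pos_of_lt_pi (by positivity) (by nlinarith [Real.pi_pos])

theorem two_mul_le_sin_pi_mul {t θ : ℝ} (hθ : 0 ≤ θ) (h0 : θ ≤ t) (h1 : t ≤ 1 - θ) :
    2 * θ ≤ Real.sin (Real.pi * t) := by
  have hpi := Real.pi_pos
  rcases le_total t (1 / 2) with h | h
  · have := Real.mul_le_sin (x := Real.pi * t) (by nlinarith) (by nlinarith)
    have e : 2 / Real.pi * (Real.pi * t) = 2 * t := by field_simp
    linarith
  · have := Real.mul_le_sin (x := Real.pi * (1 - t)) (by nlinarith) (by nlinarith)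
    have e : 2 / Real.pi * (Real.pi * (1 - t)) = 2 * (1 - t) := by field_simp
    have e2 : Real.pi * (1 - t) = Real.pi - Real.pi * t := by ring
    rw [e, e2, Real.sin_pi_sub] at this
    linarith

/-- After cross-multiplication this is sin(π(t - s)) ≥ 0. -/
theorem cot_pi_mul_antitone {s t : ℝ} (h0 : 0 < s) (hst : s ≤ t) (h1 : t < 1) :
    Real.cos (Real.pi * t) / Real.sin (Real.pi * t) ≤
      Real.cos (Real.pi * s) / Real.sin (Real.pi * s) := by
  have hs := sin_pi_mul_pos h0 (hst.trans_lt h1)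
  have ht := sin_pi_mul_pos (h0.trans_le hst) h1
  rw [div_le_div_iff₀ ht hs]
  have : 0 ≤ Real.sin (Real.pi * t - Real.pi * s) := by
    apply Real.sin_nonneg_of_nonneg_of_le_pi <;> nlinarith [Real.pi_pos]
  rw [Real.sin_sub] at this
  linarith

theorem abs_cot_pi_mul_le {t θ : ℝ} (hθ : 0 < θ) (h0 : θ ≤ t) (h1 : t ≤ 1 - θ) :
    |Real.cos (Real.pi * t) / Real.sin (Real.pi * t)| ≤ 1 / (2 * θ) := by
  have h := two_mul_le_sin_pi_mul hθ.le h0 h1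
  have hp : 0 < Real.sin (Real.pi * t) := by linarith
  rw [abs_div, abs_of_pos hp]
  exact div_le_div₀ zero_le_one (Real.abs_cos_le_one _) (by positivity) h

theorem norm_cotKernel_le {t θ : ℝ} (hθ : 0 < θ) (h0 : θ ≤ t) (h1 : t ≤ 1 - θ) :
    ‖cotKernel t‖ ≤ 1 / (2 * θ) := by
  have h := abs_cot_pi_mul_le hθ h0 h1
  have h2 : (1 : ℝ) ≤ 1 / (2 * θ) := by rw [le_div_iff₀ (by positivity)]; linarith
  calc ‖cotKernel t‖ ≤ ‖(-1 / 2 : ℂ)‖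
        + ‖Complex.I / 2 * (Real.cos (Real.pi * t) / Real.sin (Real.pi * t) : ℝ)‖ := norm_sub_le _ _
    _ = 1 / 2 + 1 / 2 * |Real.cos (Real.pi * t) / Real.sin (Real.pi * t)| := by
        rw [norm_mul, Complex.norm_real, Real.norm_eq_abs]; simp
    _ ≤ _ := by linarith

/-- The kernel has constant real part, so a difference is purely imaginary. Along a monotone
sequence these norms telescope, which is what the partial summation needs. -/
theorem norm_cotKernel_sub {s t : ℝ} (h0 : 0 < s) (hst : s ≤ t) (h1 : t < 1) :
    ‖cotKernel s - cotKernel t‖ = (Real.cos (Real.pi * s) / Real.sin (Real.pi * s)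
      - Real.cos (Real.pi * t) / Real.sin (Real.pi * t)) / 2 := by
  have h := cot_pi_mul_antitone h0 hst h1
  have e : cotKernel s - cotKernel t = -(Complex.I / 2) *
      ((Real.cos (Real.pi * s) / Real.sin (Real.pi * s)
      - Real.cos (Real.pi * t) / Real.sin (Real.pi * t) : ℝ) : ℂ) := by
    rw [cotKernel, cotKernel]; push_cast; ring
  rw [e, norm_mul, Complex.norm_real, Real.norm_eq_abs, abs_of_nonneg (by linarith)]
  simp; ring

/-- The Kusmin–Landau inequality, for slopes between `θ` and `1 - θ`. -/
theorem kusmin_landau_of_unit (a : ℕ → ℝ) {p q : ℕ} {θ : ℝ} (hθ : 0 < θ)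
    (hΔ : ∀ n ∈ Finset.Ico p q, θ ≤ a (n + 1) - a n ∧ a (n + 1) - a n ≤ 1 - θ)
    (hmono : ∀ n, p ≤ n → n + 1 < q → a (n + 1) - a n ≤ a (n + 2) - a (n + 1)) :
    ‖∑ n ∈ Finset.Ico p q, expTwoPiI (a n)‖ ≤ 2 / θ := by
  rcases le_or_gt q p with hqp | hpq
  · rw [Finset.Ico_eq_empty_of_le hqp]; simp; positivity
  set D : ℕ → ℝ := fun n => a (n + 1) - a n with hD
  set r : ℕ → ℝ := fun n => Real.cos (Real.pi * D n) / Real.sin (Real.pi * D n) with hr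
  set c : ℕ → ℂ := fun n => cotKernel (D n) with hc
  set E : ℕ → ℂ := fun n => expTwoPiI (a n) with hE
  -- Each term is a difference of consecutive terms multiplied by 1/(e(D n) - 1), which prepares
  -- summation by parts.
  have hstep : ∀ n ∈ Finset.Ico p q, E n = c n * E (n + 1) - c n * E n := by
    intro n hn
    have h := hΔ n hn
    have h1 := cotKernel_mul (D n) (sin_pi_mul_pos (by linarith [h.1]) (by linarith [h.2])).ne'
    have h2 : E (n + 1) = E n * expTwoPiI (D n) := by
      simp only [hE, hD]; rw [← expTwoPiI_add]; congr 1; ring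
    rw [h2]; linear_combination -(E n) * h1
  -- Summation by parts: apart from the two boundary terms, only the variation of `c` remains, and
  -- it telescopes to half the drop of the cotangent.
  have key : ∀ j, p + j < q →
      ‖∑ n ∈ Finset.Ico p (p + j + 1), E n - c (p + j) * E (p + j + 1) + c p * E p‖
        ≤ (r p - r (p + j)) / 2 := by
    intro j
    induction j with
    | zero =>
      intro hj
      simp only [add_zero, Nat.Ico_succ_singleton, Finset.sum_singleton, sub_self, zero_div]
      have : E p - c p * E (p + 1) + c p * E p = 0 := by
        linear_combination hstep p (by simp; omega)
      rw [this]; simp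
    | succ j ih =>
      intro hj
      have ih := ih (by omega)
      have hm : p + (j + 1) ∈ Finset.Ico p q := by simp; omega
      have hm' : p + j ∈ Finset.Ico p q := by simp; omega
      have e : ∑ n ∈ Finset.Ico p (p + (j + 1) + 1), E n - c (p + (j + 1)) * E (p + (j + 1) + 1)
          + c p * E p = (∑ n ∈ Finset.Ico p (p + j + 1), E n - c (p + j) * E (p + j + 1) + c p * E p)
          + (c (p + j) - c (p + (j + 1))) * E (p + (j + 1)) := by
        rw [Finset.sum_Ico_succ_top (by omega)]
        linear_combination hstep _ hm
      rw [e]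
      refine (norm_add_le _ _).trans ?_
      have h1 := hΔ _ hm
      have h2 := hΔ _ hm'
      have h3 := norm_cotKernel_sub (s := D (p + j)) (t := D (p + (j + 1))) (by linarith [h2.1])
        (hmono _ (by omega) (by omega)) (by linarith [h1.2])
      rw [norm_mul, norm_expTwoPiI, mul_one]
      simp only [hc, hr] at *
      rw [h3]; linarith
  obtain ⟨j, rfl⟩ : ∃ j, q = p + j + 1 := ⟨q - p - 1, by omega⟩
  have hp := hΔ p (by simp)
  have hq := hΔ (p + j) (by simp)
  have k := key j (by omega)
  have n1 : ‖c p‖ ≤ 1 / (2 * θ) := norm_cotKernel_le hθ hp.1 hp.2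
  have n2 : ‖c (p + j)‖ ≤ 1 / (2 * θ) := norm_cotKernel_le hθ hq.1 hq.2
  have r1 : |r p| ≤ 1 / (2 * θ) := abs_cot_pi_mul_le hθ hp.1 hp.2
  have r2 : |r (p + j)| ≤ 1 / (2 * θ) := abs_cot_pi_mul_le hθ hq.1 hq.2
  have e : ∑ n ∈ Finset.Ico p (p + j + 1), E n =
      (∑ n ∈ Finset.Ico p (p + j + 1), E n - c (p + j) * E (p + j + 1) + c p * E p)
        + (c (p + j) * E (p + j + 1) - c p * E p) := by ring
  rw [e]
  refine (norm_add_le _ _).trans ?_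
  have n3 : ‖c (p + j) * E (p + j + 1) - c p * E p‖ ≤ ‖c (p + j)‖ + ‖c p‖ := by
    refine (norm_sub_le _ _).trans ?_
    rw [norm_mul, norm_mul, norm_expTwoPiI, norm_expTwoPiI, mul_one, mul_one]
  have hh : 1 / (2 * θ) * 4 = 2 / θ := by field_simp; norm_num
  have := neg_abs_le (r (p + j))
  have := le_abs_self (r p)
  have : 0 < 1 / (2 * θ) := by positivity
  linarith

/-- Subtracting the integer k * n from the phase changes no term and moves the slopes into the unit
interval. -/
theorem kusmin_landau (a : ℕ → ℝ) {p q : ℕ} {θ : ℝ} (k : ℤ) (hθ : 0 < θ)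
    (hΔ : ∀ n ∈ Finset.Ico p q, k + θ ≤ a (n + 1) - a n ∧ a (n + 1) - a n ≤ k + 1 - θ)
    (hmono : ∀ n, p ≤ n → n + 1 < q → a (n + 1) - a n ≤ a (n + 2) - a (n + 1)) :
    ‖∑ n ∈ Finset.Ico p q, expTwoPiI (a n)‖ ≤ 2 / θ := by
  have h := kusmin_landau_of_unit (fun n => a n - k * n) (p := p) (q := q) hθ
    (fun n hn => by have := hΔ n hn; push_cast; constructor <;> linarith)
    (fun n h1 h2 => by have := hmono n h1 h2; push_cast; linarith)
  convert h using 3 with n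
  have e : a n = (a n - k * n) + ((k * n : ℤ) : ℝ) := by push_cast; ring
  conv_lhs => rw [e, expTwoPiI_add, expTwoPiI_intCast, mul_one]

/-! ### The second derivative test for exponential sums -/

theorem Finset.eq_Ico_of_ordConnected (s : Finset ℕ)
    (h : ∀ i ∈ s, ∀ j ∈ s, ∀ k, i ≤ k → k ≤ j → k ∈ s) : ∃ p q, s = Finset.Ico p q := by
  rcases s.eq_empty_or_nonempty with rfl | hs
  · exact ⟨0, 0, by simp⟩
  refine ⟨s.min' hs, s.max' hs + 1, ?_⟩
  ext k
  simp only [Finset.mem_Ico]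
  exact ⟨fun hk => ⟨s.min'_le k hk, Nat.lt_succ_of_le (s.le_max' k hk)⟩,
    fun hk => h _ (s.min'_mem hs) _ (s.max'_mem hs) k hk.1 (by omega)⟩

theorem difference_growth (D : ℕ → ℝ) {N : ℕ} {l u : ℝ}
    (h : ∀ n < N, l ≤ D (n + 1) - D n ∧ D (n + 1) - D n ≤ u) {i j : ℕ} (hij : i ≤ j) (hj : j ≤ N) :
    l * (j - i) ≤ D j - D i ∧ D j - D i ≤ u * (j - i) := by
  induction j, hij using Nat.le_induction with
  | base => simp
  | succ j hij ih =>
    have := ih (by omega)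
    have := h j (by omega)
    push_cast
    constructor <;> linarith

/-- A sequence growing by at least l per step stays in a window of width θ for at most θ/l steps. -/
theorem card_filter_le_of_growth (D : ℕ → ℝ) {N : ℕ} {l u : ℝ} (hl : 0 < l)
    (h : ∀ n < N, l ≤ D (n + 1) - D n ∧ D (n + 1) - D n ≤ u) {θ v : ℝ} (hθ : 0 ≤ θ)
    (s : Finset ℕ) (hs : ∀ n ∈ s, n < N ∧ v ≤ D n ∧ D n ≤ v + θ) :
    (s.card : ℝ) ≤ θ / l + 1 := by
  rcases s.eq_empty_or_nonempty with rfl | hne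
  · simp; positivity
  have h1 := hs _ (s.min'_mem hne)
  have h2 := hs _ (s.max'_mem hne)
  have hle : s.min' hne ≤ s.max' hne := s.min'_le _ (s.max'_mem hne)
  have hg := (difference_growth D h hle h2.1.le).1
  have hc : s.card ≤ s.max' hne + 1 - s.min' hne := by
    rw [← Nat.card_Ico]
    refine Finset.card_le_card fun k hk => ?_
    simp only [Finset.mem_Ico]
    exact ⟨s.min'_le k hk, Nat.lt_succ_of_le (s.le_max' k hk)⟩
  have hc' : (s.card : ℝ) + (s.min' hne : ℕ) ≤ (s.max' hne : ℕ) + 1 := by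
    exact_mod_cast (by omega : s.card + s.min' hne ≤ s.max' hne + 1)
  have : ((s.max' hne : ℕ) : ℝ) - (s.min' hne : ℕ) ≤ θ / l := by
    rw [le_div_iff₀ hl]; linarith
  linarith

/-- The second derivative test for exponential sums, in terms of second differences. -/
theorem norm_sum_expTwoPiI_le (a : ℕ → ℝ) {N : ℕ} {l A : ℝ} (hl : 0 < l) (hA : 0 ≤ A)
    (h : ∀ n < N, l ≤ a (n + 2) - 2 * a (n + 1) + a n ∧ a (n + 2) - 2 * a (n + 1) + a n ≤ A * l) :
    ‖∑ n ∈ Finset.range N, expTwoPiI (a n)‖ ≤ (6 * A + 12) * (N * √l + 1 / √l) := by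
  have hs : 0 < √l := Real.sqrt_pos.2 hl
  have htriv : ∀ s : Finset ℕ, ‖∑ n ∈ s, expTwoPiI (a n)‖ ≤ s.card := fun s =>
    (norm_sum_le _ _).trans (by simp [norm_expTwoPiI])
  rcases le_or_gt 1 l with h1 | h1
  · have h2 : 1 ≤ √l := Real.one_le_sqrt.2 h1
    have h3 := htriv (Finset.range N)
    rw [Finset.card_range] at h3
    have h4 : (N : ℝ) ≤ N * √l := le_mul_of_one_le_right (by positivity) h2
    have h5 : 0 < 1 / √l := by positivity
    nlinarith [mul_nonneg hA (by positivity : 0 ≤ N * √l + 1 / √l)]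
  rcases Nat.eq_zero_or_pos N with rfl | hN
  · simp; positivity
  set D : ℕ → ℝ := fun n => a (n + 1) - a n with hD
  have hg : ∀ n < N, l ≤ D (n + 1) - D n ∧ D (n + 1) - D n ≤ A * l := fun n hn => by
    have := h n hn
    simp only [hD]
    constructor <;> linarith
  have hmono : ∀ i j, i ≤ j → j < N → D i ≤ D j := fun i j hij hj => by
    have := (difference_growth D hg hij hj.le).1
    have : (0 : ℝ) ≤ l * (j - i) := mul_nonneg hl.le (by simpa using hij)
    linarith
  set K := Finset.Icc ⌊D 0⌋ ⌊D (N - 1)⌋ with hK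
  have hmaps : ∀ n ∈ Finset.range N, ⌊D n⌋ ∈ K := fun n hn => by
    rw [Finset.mem_range] at hn
    exact Finset.mem_Icc.2 ⟨Int.floor_le_floor (hmono _ _ (by omega) hn),
      Int.floor_le_floor (hmono _ _ (by omega) (by omega))⟩
  rw [← Finset.sum_fiberwise_of_maps_to hmaps]
  -- For slopes in [k, k + 1): those at distance at least √l from both ends form an interval, where
  -- Kusmin–Landau gives 2/√l. Near each end at most 1/√l + 1 ≤ 2/√l indices remain, counted
  -- trivially. The margin √l balances the two bounds.
  have hpiece : ∀ k ∈ K, ‖∑ n ∈ Finset.range N with ⌊D n⌋ = k, expTwoPiI (a n)‖ ≤ 6 / √l := by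
    intro k _
    set J := Finset.range N with hJ
    have hsplit : ∑ n ∈ J with ⌊D n⌋ = k, expTwoPiI (a n) =
        ∑ n ∈ J with (k + √l ≤ D n ∧ D n ≤ k + 1 - √l), expTwoPiI (a n)
        + (∑ n ∈ J with (k ≤ D n ∧ D n < k + √l ∧ ⌊D n⌋ = k), expTwoPiI (a n)
        + ∑ n ∈ J with (k + √l ≤ D n ∧ k + 1 - √l < D n ∧ ⌊D n⌋ = k), expTwoPiI (a n)) := by
      simp only [Finset.sum_filter]
      rw [← Finset.sum_add_distrib, ← Finset.sum_add_distrib]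
      refine Finset.sum_congr rfl fun n _ => ?_
      by_cases hf : ⌊D n⌋ = k
      · have hf2 := Int.floor_eq_iff.1 hf
        by_cases c1 : D n < k + √l
        · simp [hf, c1, hf2.1, not_le.2 c1]
        · by_cases c2 : k + 1 - √l < D n
          · simp [hf, c1, c2, not_lt.1 c1, not_le.2 c2]
          · simp [hf, c1, c2, not_lt.1 c1, not_lt.1 c2]
      · have : ¬ (k + √l ≤ D n ∧ D n ≤ k + 1 - √l) := fun hh =>
          hf (Int.floor_eq_iff.2 ⟨by linarith [hh.1], by linarith [hh.2]⟩)
        simp [hf, this]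
    rw [hsplit]
    have b1 : ‖∑ n ∈ J with (k + √l ≤ D n ∧ D n ≤ k + 1 - √l), expTwoPiI (a n)‖ ≤ 2 / √l := by
      obtain ⟨p, q, hpq⟩ := Finset.eq_Ico_of_ordConnected
        (J.filter fun n => k + √l ≤ D n ∧ D n ≤ k + 1 - √l) (by
          intro i hi j hj m him hmj
          simp only [Finset.mem_filter, hJ, Finset.mem_range] at hi hj ⊢
          have := hmono i m him (by omega)
          have := hmono m j hmj (by omega)
          exact ⟨by omega, by linarith [hi.2.1], by linarith [hj.2.2]⟩)
      rw [hpq]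
      have hmem : ∀ n ∈ Finset.Ico p q, n < N ∧ k + √l ≤ D n ∧ D n ≤ k + 1 - √l := fun n hn => by
        rw [← hpq] at hn
        simpa [hJ] using hn
      refine kusmin_landau a k hs (fun n hn => (hmem n hn).2) fun n hn1 hn2 => ?_
      exact hmono n (n + 1) (by omega) (hmem (n + 1) (Finset.mem_Ico.2 ⟨by omega, hn2⟩)).1
    have hll : √l / l = 1 / √l := by
      rw [div_eq_div_iff hl.ne' hs.ne', one_mul, Real.mul_self_sqrt hl.le]
    have b2 : ‖∑ n ∈ J with (k ≤ D n ∧ D n < k + √l ∧ ⌊D n⌋ = k), expTwoPiI (a n)‖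
        ≤ 1 / √l + 1 := by
      rw [← hll]
      refine (htriv _).trans (card_filter_le_of_growth D hl hg (v := k) hs.le _ fun n hn => ?_)
      simp only [Finset.mem_filter, hJ, Finset.mem_range] at hn
      exact ⟨hn.1, hn.2.1, hn.2.2.1.le⟩
    have b3 : ‖∑ n ∈ J with (k + √l ≤ D n ∧ k + 1 - √l < D n ∧ ⌊D n⌋ = k), expTwoPiI (a n)‖
        ≤ 1 / √l + 1 := by
      rw [← hll]
      refine (htriv _).trans
        (card_filter_le_of_growth D hl hg (v := k + 1 - √l) hs.le _ fun n hn => ?_)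
      simp only [Finset.mem_filter, hJ, Finset.mem_range] at hn
      have := (Int.floor_eq_iff.1 hn.2.2.2).2
      exact ⟨hn.1, hn.2.2.1.le, by linarith⟩
    have h6 : 1 ≤ 1 / √l := by
      rw [le_div_iff₀ hs, one_mul, Real.sqrt_le_one]; exact h1.le
    refine (norm_add_le _ _).trans ?_
    have := norm_add_le (∑ n ∈ J with (k ≤ D n ∧ D n < k + √l ∧ ⌊D n⌋ = k), expTwoPiI (a n))
      (∑ n ∈ J with (k + √l ≤ D n ∧ k + 1 - √l < D n ∧ ⌊D n⌋ = k), expTwoPiI (a n))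
    have e : (6 : ℝ) / √l = 6 * (1 / √l) := by ring
    have e2 : (2 : ℝ) / √l = 2 * (1 / √l) := by ring
    rw [e]; rw [e2] at b1
    linarith
  refine (norm_sum_le _ _).trans ((Finset.sum_le_card_nsmul _ _ _ hpiece).trans ?_)
  -- The slope increases by at most A * l * N in total, so it meets at most that many unit
  -- intervals, plus two.
  have hcard : (K.card : ℝ) ≤ A * l * N + 2 := by
    have hle : ⌊D 0⌋ ≤ ⌊D (N - 1)⌋ := Int.floor_le_floor (hmono _ _ (by omega) (by omega))
    have e : (K.card : ℝ) = ⌊D (N - 1)⌋ + 1 - ⌊D 0⌋ := by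
      rw [hK, Int.card_Icc]
      have : ((Int.toNat (⌊D (N - 1)⌋ + 1 - ⌊D 0⌋) : ℤ) : ℝ) = ((⌊D (N - 1)⌋ + 1 - ⌊D 0⌋ : ℤ) : ℝ) := by
        rw [Int.toNat_of_nonneg (by omega)]
      push_cast at this
      exact_mod_cast this
    have h7 := (difference_growth D hg (Nat.zero_le (N - 1)) (by omega)).2
    have h8 : A * l * ((N - 1 : ℕ) - (0 : ℕ)) ≤ A * l * N := by
      refine mul_le_mul_of_nonneg_left ?_ (by positivity)
      have : ((N - 1 : ℕ) : ℝ) ≤ N := by exact_mod_cast Nat.sub_le _ _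
      simp [this]
    have := Int.floor_le (D (N - 1))
    have := Int.lt_floor_add_one (D 0)
    linarith
  rw [nsmul_eq_mul]
  calc (K.card : ℝ) * (6 / √l) ≤ (A * l * N + 2) * (6 / √l) := by gcongr
    _ = 6 * A * (N * √l) + 12 * (1 / √l) := by
        have : l = √l * √l := (Real.mul_self_sqrt hl.le).symm
        conv_lhs => enter [1, 1, 1, 2]; rw [this]
        field_simp
        ring
    _ ≤ _ := by
        have : 0 ≤ N * √l := by positivity
        have : 0 ≤ A * (1 / √l) := by positivity
        nlinarith

/-! ### The sawtooth function and its periodic primitive -/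

/-- The sawtooth function `{t} - 1/2`. -/
noncomputable def sawtooth (t : ℝ) : ℝ := Int.fract t - 1 / 2

theorem abs_sawtooth_le (t : ℝ) : |sawtooth t| ≤ 1 / 2 := by
  have := Int.fract_nonneg t
  have := Int.fract_lt_one t
  rw [sawtooth, abs_le]; constructor <;> linarith

/-- The periodic quadratic `{t}² - {t}`, twice a primitive of the sawtooth function. -/
noncomputable def sawtoothPrimitive (t : ℝ) : ℝ := Int.fract t ^ 2 - Int.fract t

theorem fract_add_eq_or (t δ : ℝ) (h0 : 0 ≤ δ) (h1 : δ ≤ 1) :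
    Int.fract (t + δ) = Int.fract t + δ ∨
      (Int.fract (t + δ) = Int.fract t + δ - 1 ∧ 1 ≤ Int.fract t + δ) := by
  have a0 := Int.fract_nonneg t
  have a1 := Int.fract_lt_one t
  have e := Int.floor_add_fract t
  rcases lt_or_ge (Int.fract t + δ) 1 with h | h
  · left
    exact Int.fract_eq_iff.2 ⟨by linarith, h, ⌊t⌋, by linarith⟩
  · right
    exact ⟨Int.fract_eq_iff.2 ⟨by linarith, by linarith, ⌊t⌋ + 1, by push_cast; linarith⟩, h⟩

theorem fract_sub_eq_or (t δ : ℝ) (h0 : 0 ≤ δ) (h1 : δ ≤ 1) :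
    Int.fract (t - δ) = Int.fract t - δ ∨
      (Int.fract (t - δ) = Int.fract t - δ + 1 ∧ Int.fract t - δ ≤ 0) := by
  have a0 := Int.fract_nonneg t
  have a1 := Int.fract_lt_one t
  have e := Int.floor_add_fract t
  rcases le_or_gt 0 (Int.fract t - δ) with h | h
  · left
    exact Int.fract_eq_iff.2 ⟨by linarith, by linarith, ⌊t⌋, by linarith⟩
  · right
    exact ⟨Int.fract_eq_iff.2 ⟨by linarith, by linarith, ⌊t⌋ - 1, by push_cast; linarith⟩, h.le⟩

/-- The sawtooth has slope 1 and only downward jumps, so ψ(t + u) ≤ ψ(t) + u for u ≥ 0; the bound is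
this inequality integrated. The backward version below follows in the same way. -/
theorem sawtoothPrimitive_add_sub_le (t δ : ℝ) (h0 : 0 ≤ δ) (h1 : δ ≤ 1) :
    sawtoothPrimitive (t + δ) - sawtoothPrimitive t ≤ 2 * δ * sawtooth t + δ ^ 2 := by
  simp only [sawtoothPrimitive, sawtooth]
  rcases fract_add_eq_or t δ h0 h1 with h | ⟨h, h'⟩ <;> rw [h] <;> nlinarith

theorem le_sawtoothPrimitive_sub (t δ : ℝ) (h0 : 0 ≤ δ) (h1 : δ ≤ 1) :
    2 * δ * sawtooth t - δ ^ 2 ≤ sawtoothPrimitive t - sawtoothPrimitive (t - δ) := by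
  simp only [sawtoothPrimitive, sawtooth]
  rcases fract_sub_eq_or t δ h0 h1 with h | ⟨h, h'⟩ <;> rw [h] <;> nlinarith

/-- The Fourier expansion of the Bernoulli polynomial B₂ = t² - t + 1/6 at the fractional part. The
term h = 0 vanishes because division by zero gives 0. -/
theorem hasSum_sawtoothPrimitive (t : ℝ) :
    HasSum (fun h : ℕ => 1 / (h : ℝ) ^ 2 * Real.cos (2 * Real.pi * (h * t)))
      (Real.pi ^ 2 * (sawtoothPrimitive t + 6⁻¹)) := by
  have h := hasSum_one_div_nat_pow_mul_cos one_ne_zero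
    (x := Int.fract t) ⟨Int.fract_nonneg t, (Int.fract_lt_one t).le⟩
  convert h using 1
  · funext n
    have e : 2 * Real.pi * (n * t) = 2 * Real.pi * n * Int.fract t
        + ((n * ⌊t⌋ : ℤ) : ℝ) * (2 * Real.pi) := by
      have := Int.floor_add_fract t
      push_cast
      linear_combination (-(2 * Real.pi * n)) * this
    rw [e, Real.cos_add_int_mul_two_pi, mul_one]
  · have e : (Polynomial.map (algebraMap ℚ ℝ) (Polynomial.bernoulli (2 * 1))).eval (Int.fract t)
        = bernoulliFun 2 (Int.fract t) := rfl
    rw [e, bernoulliFun_two, sawtoothPrimitive]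
    rw [show (Nat.factorial (2 * 1) : ℝ) = 2 by norm_num [Nat.factorial]]
    ring

theorem re_expTwoPiI (t : ℝ) : (expTwoPiI t).re = Real.cos (2 * Real.pi * t) := by
  rw [expTwoPiI, Complex.exp_ofReal_mul_I_re]

theorem norm_expTwoPiI_sub_one_le {t u : ℝ} (h : |t| ≤ u) :
    ‖expTwoPiI t - 1‖ ≤ 2 * Real.pi * min 1 u := by
  rw [mul_min_of_nonneg _ _ (by positivity), le_min_iff]
  constructor
  · refine (norm_sub_le _ _).trans ?_
    rw [norm_expTwoPiI, norm_one]
    linarith [Real.pi_gt_three]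
  · have := Real.norm_exp_I_mul_ofReal_sub_one_le (x := 2 * Real.pi * t)
    rw [mul_comm Complex.I] at this
    refine this.trans ?_
    rw [Real.norm_eq_abs, abs_mul, abs_of_pos (by positivity)]
    gcongr

/-! ### Weighted sums of h^{-3/2} -/

theorem inv_sqrt_step (M : ℕ) :
    1 / √((M : ℝ) + 1) ≤ 2 * (√((M : ℝ) + 1) - √M) := by
  have ha : 0 ≤ √(M : ℝ) := Real.sqrt_nonneg _
  have hb : 0 < √((M : ℝ) + 1) := Real.sqrt_pos.2 (by positivity)
  have ha2 : √(M : ℝ) ^ 2 = M := Real.sq_sqrt (by positivity)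
  have hb2 : √((M : ℝ) + 1) ^ 2 = M + 1 := Real.sq_sqrt (by positivity)
  rw [div_le_iff₀ hb]
  nlinarith [sq_nonneg (√((M : ℝ) + 1) - √M)]

theorem inv_mul_sqrt_step {M : ℕ} (hM : 1 ≤ M) :
    1 / (((M : ℝ) + 1) * √((M : ℝ) + 1)) ≤ 2 / √M - 2 / √((M : ℝ) + 1) := by
  have hM' : (0 : ℝ) < M := by exact_mod_cast hM
  have ha : 0 < √(M : ℝ) := Real.sqrt_pos.2 hM'
  have hb : 0 < √((M : ℝ) + 1) := Real.sqrt_pos.2 (by positivity)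
  have ha2 : √(M : ℝ) ^ 2 = M := Real.sq_sqrt (by positivity)
  have hb2 : √((M : ℝ) + 1) ^ 2 = M + 1 := Real.sq_sqrt (by positivity)
  have h1 := inv_sqrt_step M
  have hab : √(M : ℝ) ≤ √((M : ℝ) + 1) := Real.sqrt_le_sqrt (by linarith)
  have e1 : 1 / (((M : ℝ) + 1) * √((M : ℝ) + 1)) = 1 / √((M : ℝ) + 1) / (M + 1) := by
    field_simp
  have e2 : 2 / √M - 2 / √((M : ℝ) + 1) = 2 * (√((M : ℝ) + 1) - √M) / (√M * √((M : ℝ) + 1)) := by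
    field_simp
  rw [e1, e2]
  refine div_le_div₀ (by linarith) h1 (by positivity) ?_
  nlinarith

theorem sum_range_inv_mul_sqrt_le (M : ℕ) :
    ∑ h ∈ Finset.range M, 1 / ((h : ℝ) * √h) ≤ 3 := by
  have key : ∀ M : ℕ, 1 ≤ M →
      ∑ h ∈ Finset.range (M + 1), 1 / ((h : ℝ) * √h) ≤ 3 - 2 / √M := by
    intro M hM
    induction M, hM using Nat.le_induction with
    | base => norm_num [Finset.sum_range_succ]
    | succ M hM ih =>
      rw [Finset.sum_range_succ]
      have := inv_mul_sqrt_step hM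
      push_cast
      linarith
  rcases M with _ | _ | M
  · simp
  · simp
  · refine (key (M + 1) (by omega)).trans ?_
    have : 0 ≤ 2 / √((M + 1 : ℕ) : ℝ) := by positivity
    linarith

/-- Up to H the terms are at most h^{-1/2}/H, beyond H at most h^{-3/2}; each range contributes at
most 2/√H. -/
theorem sum_range_min_div_le {H : ℕ} (hH : 1 ≤ H) (M : ℕ) :
    ∑ h ∈ Finset.range M, min 1 ((h : ℝ) / H) / ((h : ℝ) * √h) ≤ 4 / √H := by
  have hH0 : (0 : ℝ) < H := by exact_mod_cast hH
  have hs : 0 < √(H : ℝ) := Real.sqrt_pos.2 hH0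
  have hs2 : √(H : ℝ) ^ 2 = H := Real.sq_sqrt hH0.le
  set T : ℕ → ℝ := fun h => min 1 ((h : ℝ) / H) / ((h : ℝ) * √h) with hT
  have hT0 : ∀ h, 0 ≤ T h := fun h => by simp only [hT]; positivity
  have key1 : ∀ M : ℕ, ∑ h ∈ Finset.range (M + 1), T h ≤ 2 * √M / H := by
    intro M
    induction M with
    | zero => simp [hT]
    | succ M ih =>
      rw [Finset.sum_range_succ]
      have h1 := inv_sqrt_step M
      have h2 : T (M + 1) ≤ 1 / √((M : ℝ) + 1) / H := by
        simp only [hT]; push_cast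
        have hp : 0 < √((M : ℝ) + 1) := Real.sqrt_pos.2 (by positivity)
        calc _ ≤ ((M : ℝ) + 1) / H / (((M : ℝ) + 1) * √((M : ℝ) + 1)) := by
              gcongr; exact min_le_right _ _
          _ = _ := by field_simp
      have h3 : 1 / √((M : ℝ) + 1) / H ≤ 2 * (√((M : ℝ) + 1) - √M) / H := by gcongr
      have e : 2 * √((M + 1 : ℕ) : ℝ) / H
          = 2 * √(M : ℝ) / H + 2 * (√((M : ℝ) + 1) - √M) / H := by push_cast; ring
      rw [e]; linarith
  have key2 : ∀ M : ℕ, H ≤ M → ∑ h ∈ Finset.range (M + 1), T h ≤ 4 / √H - 2 / √M := by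
    intro M hM
    induction M, hM using Nat.le_induction with
    | base =>
      refine (key1 H).trans (le_of_eq ?_)
      rw [mul_div_assoc, Real.sqrt_div_self]; ring
    | succ M hM ih =>
      rw [Finset.sum_range_succ]
      have h1 := inv_mul_sqrt_step (hH.trans hM)
      have h2 : T (M + 1) ≤ 1 / (((M : ℝ) + 1) * √((M : ℝ) + 1)) := by
        simp only [hT]; push_cast
        gcongr; exact min_le_left _ _
      push_cast
      linarith
  calc ∑ h ∈ Finset.range M, T h ≤ ∑ h ∈ Finset.range (max M H + 1), T h :=
        Finset.sum_le_sum_of_subset_of_nonneg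
          (Finset.range_subset_range.2 (by omega)) fun _ _ _ => hT0 _
    _ ≤ 4 / √H - 2 / √(max M H : ℕ) := key2 _ (by omega)
    _ ≤ 4 / √H := by
        have : 0 ≤ 2 / √((max M H : ℕ) : ℝ) := by positivity
        linarith

/-! ### Sawtooth sums from exponential sums -/

/-- Shifting the argument of the periodic quadratic by `±1/H`, summed over a sequence whose
exponential sums satisfy the bounds of the second derivative test. -/
theorem abs_sum_sawtoothPrimitive_sub_le (a : ℕ → ℝ) {N H : ℕ} {l Q η : ℝ} (hl : 0 < l)
    (hQ : 0 ≤ Q) (hH : 1 ≤ H) (hη : |η| = 1 / H)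
    (hS : ∀ h : ℕ, 1 ≤ h → ‖∑ n ∈ Finset.range N, expTwoPiI (h * a n)‖
      ≤ Q * (N * √(h * l) + 1 / √(h * l))) :
    |∑ n ∈ Finset.range N, (sawtoothPrimitive (a n + η) - sawtoothPrimitive (a n))|
      ≤ Q * (4 * N * √l / √H + 3 / (H * √l)) := by
  have hH0 : (0 : ℝ) < H := by exact_mod_cast hH
  have hs : 0 < √l := Real.sqrt_pos.2 hl
  have hpi := Real.pi_gt_three
  have hsum : HasSum (fun h : ℕ => ∑ n ∈ Finset.range N,
      (1 / (h : ℝ) ^ 2 * Real.cos (2 * Real.pi * (h * (a n + η)))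
        - 1 / (h : ℝ) ^ 2 * Real.cos (2 * Real.pi * (h * a n))))
      (∑ n ∈ Finset.range N, (Real.pi ^ 2 * (sawtoothPrimitive (a n + η) + 6⁻¹)
        - Real.pi ^ 2 * (sawtoothPrimitive (a n) + 6⁻¹))) :=
    hasSum_sum fun n _ => (hasSum_sawtoothPrimitive _).sub (hasSum_sawtoothPrimitive _)
  set T : ℕ → ℝ := fun h => min 1 ((h : ℝ) / H) / ((h : ℝ) * √h) with hT
  set U : ℕ → ℝ := fun h => 1 / ((h : ℝ) * √h) with hU
  have hT0 : ∀ h, 0 ≤ T h := fun h => by simp only [hT]; positivity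
  have hU0 : ∀ h, 0 ≤ U h := fun h => by simp only [hU]; positivity
  have hTs := summable_of_sum_range_le hT0 (sum_range_min_div_le hH)
  have hUs := summable_of_sum_range_le hU0 sum_range_inv_mul_sqrt_le
  have hTt : ∑' h, T h ≤ 4 / √H := Real.tsum_le_of_sum_range_le hT0 (sum_range_min_div_le hH)
  have hUt : ∑' h, U h ≤ 3 := Real.tsum_le_of_sum_range_le hU0 sum_range_inv_mul_sqrt_le
  have hmaj := ((hTs.hasSum.mul_left (N * √l)).add (hUs.hasSum.mul_left (1 / (H * √l)))).mul_left
    (2 * Real.pi * Q)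
  -- The shift by η multiplies the h-th harmonic by e(hη) - 1, of size at most 2π min(1, h/H), which
  -- damps the frequencies below H.
  have hbound := tsum_of_norm_bounded hmaj (f := fun h : ℕ => ∑ n ∈ Finset.range N,
      (1 / (h : ℝ) ^ 2 * Real.cos (2 * Real.pi * (h * (a n + η)))
        - 1 / (h : ℝ) ^ 2 * Real.cos (2 * Real.pi * (h * a n)))) (by
    intro h
    rcases Nat.eq_zero_or_pos h with rfl | hh
    · simp [hT, hU]
    have hh0 : (0 : ℝ) < h := by exact_mod_cast hh
    have hsh : 0 < √(h : ℝ) := Real.sqrt_pos.2 hh0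
    have hsh2 : √(h : ℝ) ^ 2 = h := Real.sq_sqrt hh0.le
    have e : ∑ n ∈ Finset.range N, (1 / (h : ℝ) ^ 2 * Real.cos (2 * Real.pi * (h * (a n + η)))
        - 1 / (h : ℝ) ^ 2 * Real.cos (2 * Real.pi * (h * a n)))
        = 1 / (h : ℝ) ^ 2 * ((expTwoPiI (h * η) - 1)
            * ∑ n ∈ Finset.range N, expTwoPiI (h * a n)).re := by
      rw [Finset.mul_sum, Complex.re_sum, Finset.mul_sum]
      refine Finset.sum_congr rfl fun n _ => ?_
      rw [sub_mul, one_mul, ← expTwoPiI_add, Complex.sub_re, re_expTwoPiI, re_expTwoPiI]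
      rw [show (h : ℝ) * η + h * a n = h * (a n + η) by ring]; ring
    rw [e, Real.norm_eq_abs, abs_mul, abs_of_pos (by positivity : 0 < 1 / (h : ℝ) ^ 2)]
    have b1 : ‖expTwoPiI (h * η) - 1‖ ≤ 2 * Real.pi * min 1 ((h : ℝ) / H) :=
      norm_expTwoPiI_sub_one_le (by rw [abs_mul, hη, abs_of_pos hh0]; exact le_of_eq (by ring))
    calc 1 / (h : ℝ) ^ 2 * |((expTwoPiI (h * η) - 1)
            * ∑ n ∈ Finset.range N, expTwoPiI (h * a n)).re|
        ≤ 1 / (h : ℝ) ^ 2 * (2 * Real.pi * min 1 ((h : ℝ) / H)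
            * (Q * (N * √(h * l) + 1 / √(h * l)))) := by
          gcongr
          refine (Complex.abs_re_le_norm _).trans ?_
          rw [norm_mul]
          exact mul_le_mul b1 (hS h hh) (norm_nonneg _) (by positivity)
      _ = 2 * Real.pi * Q * (N * √l * T h + min 1 ((h : ℝ) / H) / (h ^ 2 * √h * √l)) := by
          rw [Real.sqrt_mul hh0.le]
          simp only [hT]
          have e1 : (h : ℝ) ^ 2 = h * √h * √h := by rw [mul_assoc, ← sq, hsh2, sq]
          rw [e1]; field_simp
      -- In the second term min(1, h/H) ≤ h/H already leaves the convergent series ∑ h^{-3/2}.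
      _ ≤ 2 * Real.pi * Q * (N * √l * T h + ((h : ℝ) / H) / (h ^ 2 * √h * √l)) := by
          gcongr; exact min_le_right _ _
      _ = 2 * Real.pi * Q * (N * √l * T h + 1 / (H * √l) * U h) := by
          simp only [hU]; field_simp)
  rw [hsum.tsum_eq, ← Finset.sum_congr rfl (fun n _ => show Real.pi ^ 2 *
    (sawtoothPrimitive (a n + η) - sawtoothPrimitive (a n)) = _ by ring), ← Finset.mul_sum,
    Real.norm_eq_abs, abs_mul, abs_of_pos (by positivity : 0 < Real.pi ^ 2)] at hbound
  have h5 : N * √l * ∑' h, T h + 1 / (H * √l) * ∑' h, U h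
      ≤ N * √l * (4 / √H) + 1 / (H * √l) * 3 := by gcongr
  have h6 : 2 * Real.pi * Q * (N * √l * ∑' h, T h + 1 / (H * √l) * ∑' h, U h)
      ≤ Real.pi ^ 2 * (Q * (4 * N * √l / √H + 3 / (H * √l))) := by
    calc _ ≤ 2 * Real.pi * Q * (N * √l * (4 / √H) + 1 / (H * √l) * 3) := by gcongr
      _ = 2 * Real.pi * (Q * (4 * N * √l / √H + 3 / (H * √l))) := by ring
      _ ≤ _ := by gcongr; nlinarith
  exact le_of_mul_le_mul_left (hbound.trans h6) (by positivity)

theorem abs_sum_sawtooth_le_card (a : ℕ → ℝ) (s : Finset ℕ) :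
    |∑ n ∈ s, sawtooth (a n)| ≤ s.card / 2 := by
  refine (Finset.abs_sum_le_sum_abs _ _).trans
    ((Finset.sum_le_card_nsmul _ _ _ fun n _ => abs_sawtooth_le _).trans ?_)
  rw [nsmul_eq_mul]; exact le_of_eq (by ring)

/-- The second derivative test for the sawtooth function. -/
theorem abs_sum_sawtooth_le (a : ℕ → ℝ) {N : ℕ} {μ A : ℝ} (hμ : 0 < μ) (hA : 0 ≤ A)
    (h : ∀ n < N, μ ^ 3 ≤ a (n + 2) - 2 * a (n + 1) + a n ∧
      a (n + 2) - 2 * a (n + 1) + a n ≤ A * μ ^ 3) :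
    |∑ n ∈ Finset.range N, sawtooth (a n)| ≤ (24 * A + 50) * (N * μ + 1 / (μ * √μ)) := by
  have hsμ : 0 < √μ := Real.sqrt_pos.2 hμ
  rcases le_or_gt 1 μ with h1 | h1
  · have h2 := abs_sum_sawtooth_le_card a (Finset.range N)
    rw [Finset.card_range] at h2
    have h3 : (N : ℝ) ≤ N * μ := le_mul_of_one_le_right (by positivity) h1
    have h4 : 0 ≤ 1 / (μ * √μ) := by positivity
    nlinarith [mul_nonneg hA (by positivity : 0 ≤ N * μ + 1 / (μ * √μ))]
  have hsqrt : √(μ ^ 3) = μ * √μ := by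
    rw [show μ ^ 3 = μ ^ 2 * μ by ring, Real.sqrt_mul (by positivity), Real.sqrt_sq hμ.le]
  -- With l = μ³, the choice H ≈ 1/μ balances the smoothing error N/H against N√l·√H: both are of
  -- order Nμ.
  set H : ℕ := ⌈1 / μ⌉₊ with hH
  have hHl : 1 / μ ≤ H := Nat.le_ceil _
  have h1μ : 1 ≤ 1 / μ := by rw [le_div_iff₀ hμ]; linarith
  have hHu : (H : ℝ) ≤ 2 / μ := by
    have := Nat.ceil_lt_add_one (by positivity : 0 ≤ 1 / μ)
    have e : 2 / μ = 1 / μ + 1 / μ := by ring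
    rw [e]; linarith
  have hH1 : 1 ≤ H := by exact_mod_cast h1μ.trans hHl
  have hH0 : (0 : ℝ) < H := by exact_mod_cast hH1
  set Q : ℝ := 6 * A + 12 with hQ
  have hS : ∀ h : ℕ, 1 ≤ h → ‖∑ n ∈ Finset.range N, expTwoPiI (h * a n)‖
      ≤ Q * (N * √(h * μ ^ 3) + 1 / √(h * μ ^ 3)) := fun k hk => by
    have hk0 : (0 : ℝ) < k := by exact_mod_cast hk
    refine norm_sum_expTwoPiI_le (fun n => k * a n) (by positivity) hA fun n hn => ?_
    have := h n hn
    constructor <;> nlinarith [this.1, this.2]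
  set W : ℝ := Q * (4 * N * √(μ ^ 3) / √H + 3 / (H * √(μ ^ 3))) with hW
  have hp := abs_sum_sawtoothPrimitive_sub_le a (η := 1 / H) (by positivity : 0 < μ ^ 3)
    (by positivity : 0 ≤ Q) hH1 (abs_of_pos (by positivity)) hS
  have hm := abs_sum_sawtoothPrimitive_sub_le a (η := -(1 / H)) (by positivity : 0 < μ ^ 3)
    (by positivity : 0 ≤ Q) hH1 (by rw [abs_neg, abs_of_pos (by positivity)]) hS
  have hδ1 : 1 / (H : ℝ) ≤ 1 := by rw [div_le_one hH0]; exact_mod_cast hH1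
  -- The backward difference quotient bounds the sawtooth from above, the forward one (in `lo`) from
  -- below.
  have up : 2 * (1 / (H : ℝ)) * ∑ n ∈ Finset.range N, sawtooth (a n)
      ≤ W + N * (1 / (H : ℝ)) ^ 2 := by
    have := Finset.sum_le_sum fun n (_ : n ∈ Finset.range N) =>
      le_sawtoothPrimitive_sub (a n) (1 / H) (by positivity) hδ1
    rw [Finset.sum_sub_distrib, ← Finset.mul_sum, Finset.sum_const, Finset.card_range,
      nsmul_eq_mul] at this
    have h2 := (abs_le.1 hm).1
    have e : ∑ n ∈ Finset.range N, (sawtoothPrimitive (a n + -(1 / (H : ℝ)))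
        - sawtoothPrimitive (a n)) = -∑ n ∈ Finset.range N, (sawtoothPrimitive (a n)
        - sawtoothPrimitive (a n - 1 / (H : ℝ))) := by
      rw [← Finset.sum_neg_distrib]
      exact Finset.sum_congr rfl fun n _ => by rw [sub_eq_add_neg (a n)]; ring
    rw [e] at h2
    linarith
  have lo : -(W + N * (1 / (H : ℝ)) ^ 2) ≤
      2 * (1 / (H : ℝ)) * ∑ n ∈ Finset.range N, sawtooth (a n) := by
    have := Finset.sum_le_sum fun n (_ : n ∈ Finset.range N) =>
      sawtoothPrimitive_add_sub_le (a n) (1 / H) (by positivity) hδ1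
    rw [Finset.sum_add_distrib, ← Finset.mul_sum, Finset.sum_const, Finset.card_range,
      nsmul_eq_mul] at this
    have h2 := (abs_le.1 hp).1
    linarith
  have hcomb : 2 * (1 / (H : ℝ)) * |∑ n ∈ Finset.range N, sawtooth (a n)|
      ≤ W + N * (1 / (H : ℝ)) ^ 2 := by
    rw [← abs_of_pos (by positivity : 0 < 2 * (1 / (H : ℝ))), ← abs_mul, abs_le]
    exact ⟨lo, up⟩
  have hsH : 0 < √(H : ℝ) := Real.sqrt_pos.2 hH0
  have hsH2 : √(H : ℝ) ^ 2 = H := Real.sq_sqrt hH0.le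
  have hfin : |∑ n ∈ Finset.range N, sawtooth (a n)|
      ≤ Q * (2 * N * (μ * √μ) * √H + 3 / 2 * (1 / (μ * √μ))) + N * (1 / H) / 2 := by
    have e : (H : ℝ) / 2 * (W + N * (1 / (H : ℝ)) ^ 2) =
        Q * (2 * N * (μ * √μ) * √H + 3 / 2 * (1 / (μ * √μ))) + N * (1 / H) / 2 := by
      rw [hW, hsqrt]
      have : (H : ℝ) / √H = √H := by rw [div_eq_iff hsH.ne', ← sq, hsH2]
      have e1 : (H : ℝ) / 2 * (Q * (4 * N * (μ * √μ) / √H + 3 / (H * (μ * √μ)))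
          + N * (1 / (H : ℝ)) ^ 2) = Q * (2 * N * (μ * √μ) * (H / √H)
            + 3 / 2 * (1 / (μ * √μ))) + N * (1 / H) / 2 := by field_simp; ring
      rw [e1, this]
    rw [← e]
    have e2 : |∑ n ∈ Finset.range N, sawtooth (a n)| = (H : ℝ) / 2 *
        (2 * (1 / (H : ℝ)) * |∑ n ∈ Finset.range N, sawtooth (a n)|) := by field_simp
    rw [e2]
    gcongr
  have hi : 1 / (H : ℝ) ≤ μ := by
    rw [div_le_iff₀ hH0]
    rw [div_le_iff₀ hμ] at hHl; linarith
  have hr : √μ * √H ≤ 2 := by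
    rw [← Real.sqrt_mul hμ.le]
    refine Real.sqrt_le_iff.2 ⟨by norm_num, ?_⟩
    rw [le_div_iff₀ hμ] at hHu; linarith
  have hv : 0 ≤ 1 / (μ * √μ) := by positivity
  have hNμ : 0 ≤ N * μ := by positivity
  calc _ ≤ Q * (2 * N * (μ * √μ) * √H + 3 / 2 * (1 / (μ * √μ))) + N * (1 / H) / 2 := hfin
    _ = Q * (2 * (N * μ) * (√μ * √H) + 3 / 2 * (1 / (μ * √μ))) + N * (1 / H) / 2 := by ring
    _ ≤ Q * (2 * (N * μ) * 2 + 3 / 2 * (1 / (μ * √μ))) + N * μ / 2 := by gcongr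
    _ ≤ _ := by
        rw [hQ]
        nlinarith [mul_nonneg hA hv, mul_nonneg hA hNμ]

/-! ### Sawtooth sums along a hyperbola -/

theorem second_difference_inv (y t : ℝ) (ht : 0 < t) :
    y / (t + 2) - 2 * (y / (t + 1)) + y / t = 2 * y / (t * (t + 1) * (t + 2)) := by
  have : t + 1 ≠ 0 := by positivity
  have : t + 2 ≠ 0 := by positivity
  field_simp
  ring

/-- Sums of the sawtooth function along a hyperbola, by dyadic subdivision. -/
theorem abs_sum_sawtooth_hyperbola_le {w s : ℝ} (c : ℝ) (hw : 0 < w) (hs0 : 0 ≤ s) (hs1 : s ≤ 1)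
    (j N : ℕ) (hN : N < 2 ^ j) :
    |∑ n ∈ Finset.range N, sawtooth (w ^ 3 / (n + 1 + s) - c)|
      ≤ 4000 * w * j + 60000 * (N / w * √(N / w)) := by
  induction j generalizing N with
  | zero =>
    obtain rfl : N = 0 := by simpa using hN
    simp
  | succ j ih =>
    rcases Nat.eq_zero_or_pos N with rfl | hN0
    · simp; positivity
    -- The induction handles the first half; the second half is a block of at most P = M + 1 terms
    -- on which the denominators are comparable to P.
    obtain ⟨M, L, hML, hM2, hM3⟩ : ∃ M L, N = M + L ∧ M = N / 2 ∧ L ≤ M + 1 :=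
      ⟨N / 2, N - N / 2, by omega, rfl, by omega⟩
    have ihM := ih M (by rw [pow_succ] at hN; omega)
    have hMN : (M : ℝ) ≤ N / 2 := by
      have : (2 * M : ℝ) ≤ N := by exact_mod_cast (by omega : 2 * M ≤ N)
      linarith
    have hPN : (M : ℝ) + 1 ≤ N := by exact_mod_cast (by omega : M + 1 ≤ N)
    have hLP : (L : ℝ) ≤ M + 1 := by exact_mod_cast hM3
    set P : ℝ := M + 1 with hP
    have hP0 : 1 ≤ P := by simp [hP]
    have hsplit : ∑ n ∈ Finset.range N, sawtooth (w ^ 3 / (n + 1 + s) - c) =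
        ∑ n ∈ Finset.range M, sawtooth (w ^ 3 / (n + 1 + s) - c) +
        ∑ i ∈ Finset.range L, sawtooth (w ^ 3 / (P + i + s) - c) := by
      rw [hML, Finset.sum_range_add]
      congr 1
      refine Finset.sum_congr rfl fun i _ => ?_
      congr 3
      push_cast; rw [hP]; ring
    -- Here P ≤ t and t + 2 ≤ 4P, so the second difference 2w³/(t(t+1)(t+2)) lies between (w/(4P))³
    -- and 2(w/P)³ = 128 (w/(4P))³.
    have hblock := abs_sum_sawtooth_le (fun i : ℕ => w ^ 3 / (P + i + s) - c) (N := L)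
      (μ := w / (4 * P)) (A := 128) (by positivity) (by norm_num) (by
        intro i hi
        have hi' : (i : ℝ) + 1 ≤ P := by
          have : (i : ℝ) + 1 ≤ L := by exact_mod_cast hi
          linarith
        have hi0 : (0 : ℝ) ≤ i := Nat.cast_nonneg i
        set t : ℝ := P + i + s with ht
        have ht0 : P ≤ t := by linarith
        have ht1 : t + 2 ≤ 4 * P := by linarith
        have e : (w ^ 3 / (P + ((i + 2 : ℕ) : ℝ) + s) - c) - 2 * (w ^ 3 / (P + ((i + 1 : ℕ) : ℝ) + s) - c)
            + (w ^ 3 / (P + i + s) - c) = 2 * w ^ 3 / (t * (t + 1) * (t + 2)) := by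
          rw [← second_difference_inv (w ^ 3) t (by linarith)]
          push_cast
          rw [show P + ((i : ℝ) + 2) + s = t + 2 by rw [ht]; ring,
            show P + ((i : ℝ) + 1) + s = t + 1 by rw [ht]; ring]
          ring
        rw [e]
        have e1 : (w / (4 * P)) ^ 3 = w ^ 3 / ((4 * P) * (4 * P) * (4 * P)) := by
          rw [div_pow]; ring
        have e2 : 128 * (w / (4 * P)) ^ 3 = 2 * w ^ 3 / (P * P * P) := by
          field_simp; ring
        rw [e2, e1]
        constructor
        · refine div_le_div₀ (by positivity) (by nlinarith [pow_pos hw 3]) (by positivity) ?_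
          gcongr <;> linarith
        · refine div_le_div_of_nonneg_left (by positivity) (by positivity) ?_
          gcongr <;> linarith)
    have hμ : (L : ℝ) * (w / (4 * P)) ≤ w / 4 := by
      calc (L : ℝ) * (w / (4 * P)) ≤ P * (w / (4 * P)) := by gcongr
        _ = w / 4 := by field_simp
    have hR : 1 / (w / (4 * P) * √(w / (4 * P))) ≤ 8 * (N / w * √(N / w)) := by
      have e1 : √(w / (4 * P)) = 1 / √(4 * P / w) := by
        rw [one_div, ← Real.sqrt_inv, inv_div]
      have e2 : √(4 * P / w) = 2 * √(P / w) := by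
        rw [show 4 * P / w = 2 ^ 2 * (P / w) by ring, Real.sqrt_mul (by norm_num),
          Real.sqrt_sq (by norm_num)]
      have hq : 0 < √(P / w) := Real.sqrt_pos.2 (by positivity)
      calc 1 / (w / (4 * P) * √(w / (4 * P))) = 8 * (P / w * √(P / w)) := by
            rw [e1, e2]; field_simp; norm_num
        _ ≤ _ := by gcongr
    have hRM : (M : ℝ) / w * √(M / w) ≤ (N / w * √(N / w)) / 2 := by
      calc (M : ℝ) / w * √(M / w) ≤ (N / 2) / w * √(N / w) := by
            gcongr; linarith
        _ = _ := by ring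
    rw [hsplit]
    refine (abs_add_le _ _).trans ?_
    push_cast
    have : (0 : ℝ) ≤ N / w * √(N / w) := by positivity
    nlinarith

/-! ### Counting the n with d ∣ ⌊X/n⌋ -/

/-- The number of `n ≤ X` for which `d` divides `⌊X / n⌋`. -/
def countDvdDiv (X d : ℕ) : ℕ := ((Finset.Icc 1 X).filter fun n => d ∣ X / n).card

/-- The density `∑_{e ≥ 1} 1 / (de (de + 1))` of the `n` for which `d` divides `⌊X / n⌋`. -/
noncomputable def dvdDivDensity (d : ℕ) : ℝ :=
  ∑' e : ℕ, 1 / (((d : ℝ) * (e + 1)) * (d * (e + 1) + 1))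

theorem Nat.cast_div_eq_sub_sawtooth (a b : ℕ) :
    ((a / b : ℕ) : ℝ) = a / b - 1 / 2 - sawtooth ((a : ℝ) / b) := by
  rw [sawtooth, Int.fract, ← Nat.floor_div_eq_div (K := ℝ), natCast_floor_eq_intCast_floor (by positivity)]
  ring

theorem filter_div_eq {X m : ℕ} (hm : 1 ≤ m) :
    ((Finset.Icc 1 X).filter fun n => X / n = m) = Finset.Ioc (X / (m + 1)) (X / m) := by
  ext n
  simp only [Finset.mem_filter, Finset.mem_Icc, Finset.mem_Ioc, Nat.div_lt_iff_lt_mul (Nat.succ_pos m),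
    Nat.le_div_iff_mul_le hm]
  constructor
  · rintro ⟨⟨h1, _⟩, h⟩
    have h2 := Nat.div_add_mod X n
    have h3 := Nat.mod_lt X h1
    have h4 := Nat.zero_le (X % n)
    rw [h] at h2
    constructor <;> nlinarith
  · rintro ⟨h1, h2⟩
    have hn : 1 ≤ n := by
      rcases Nat.eq_zero_or_pos n with rfl | h
      · simp at h1
      · exact h
    refine ⟨⟨hn, by nlinarith⟩, ?_⟩
    refine Nat.div_eq_of_lt_le ?_ ?_ <;> nlinarith

/-- Turns the divisibility condition into floors, hence into sawtooth values. -/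
theorem ite_dvd_eq (m d : ℕ) (hm : 1 ≤ m) :
    ((if d ∣ m then 1 else 0 : ℕ) : ℝ) = ((m / d : ℕ) : ℝ) - (((m - 1) / d : ℕ) : ℝ) := by
  obtain ⟨k, rfl⟩ : ∃ k, m = k + 1 := ⟨m - 1, by omega⟩
  rw [Nat.succ_div]
  push_cast
  simp

/-- Hyperbola method: quotients below dK are grouped by their value d(e + 1), with e + 1 < K;
quotients at least dK are those with n ≤ X/(dK), where divisibility is tested for each n separately.
-/
theorem countDvdDiv_eq (X d K : ℕ) (hd : 1 ≤ d) (hK : 1 ≤ K) :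
    (countDvdDiv X d : ℝ) =
      ∑ e ∈ Finset.range (K - 1), (((X / (d * (e + 1)) : ℕ) : ℝ) - ((X / (d * (e + 1) + 1) : ℕ) : ℝ))
      + ∑ n ∈ Finset.range (X / (d * K)),
        (((X / ((n + 1) * d) : ℕ) : ℝ) - (((X - (n + 1)) / ((n + 1) * d) : ℕ) : ℝ)) := by
  have hdK : 0 < d * K := by positivity
  have hsplit : countDvdDiv X d =
      (((Finset.Icc 1 X).filter fun n => d ∣ X / n).filter fun n => X / n < d * K).card
      + (((Finset.Icc 1 X).filter fun n => d ∣ X / n).filter fun n => ¬ X / n < d * K).card :=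
    (Finset.card_filter_add_card_filter_not _).symm
  rw [hsplit]
  push_cast
  congr 1
  · have hmaps : ∀ n ∈ ((Finset.Icc 1 X).filter fun n => d ∣ X / n).filter fun n => X / n < d * K,
        X / n / d - 1 ∈ Finset.range (K - 1) := by
      intro n hn
      simp only [Finset.mem_filter, Finset.mem_Icc] at hn
      obtain ⟨⟨⟨h1, h2⟩, k, hk⟩, h4⟩ := hn
      have h5 : 1 ≤ X / n := Nat.div_pos h2 h1
      rw [hk] at h4 h5 ⊢
      have := lt_of_mul_lt_mul_left h4 (Nat.zero_le d)
      rw [Nat.mul_div_cancel_left _ hd, Finset.mem_range]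
      have : k ≠ 0 := by rintro rfl; simp at h5
      omega
    rw [Finset.card_eq_sum_card_fiberwise hmaps]
    push_cast
    refine Finset.sum_congr rfl fun e he => ?_
    rw [Finset.mem_range] at he
    have hde : 1 ≤ d * (e + 1) := by nlinarith
    have hle : X / (d * (e + 1) + 1) ≤ X / (d * (e + 1)) := Nat.div_le_div_left (by omega) hde
    rw [← Nat.cast_sub hle, ← Nat.card_Ioc, ← filter_div_eq hde]
    congr 2
    ext n
    simp only [Finset.mem_filter, Finset.mem_Icc]
    constructor
    · rintro ⟨⟨⟨⟨h1, h2⟩, k, hk⟩, h4⟩, h6⟩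
      have h5 : 1 ≤ X / n := Nat.div_pos h2 h1
      refine ⟨⟨h1, h2⟩, ?_⟩
      rw [hk] at h6 h5 ⊢
      rw [Nat.mul_div_cancel_left _ hd] at h6
      have : k ≠ 0 := by rintro rfl; simp at h5
      congr 1; omega
    · rintro ⟨h1, h2⟩
      rw [h2, Nat.mul_div_cancel_left _ hd]
      refine ⟨⟨⟨h1, by simp⟩, ?_⟩, by omega⟩
      exact Nat.mul_lt_mul_of_pos_left (by omega) hd
  · have hset : (((Finset.Icc 1 X).filter fun n => d ∣ X / n).filter fun n => ¬ X / n < d * K)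
        = (Finset.Ico 1 (X / (d * K) + 1)).filter fun n => d ∣ X / n := by
      ext n
      simp only [Finset.mem_filter, Finset.mem_Icc, Finset.mem_Ico, not_lt, Nat.lt_succ_iff,
        Nat.le_div_iff_mul_le hdK]
      constructor
      · rintro ⟨⟨⟨h1, _⟩, h3⟩, h4⟩
        rw [Nat.le_div_iff_mul_le h1] at h4
        exact ⟨⟨h1, by rwa [mul_comm]⟩, h3⟩
      · rintro ⟨⟨h1, h2⟩, h3⟩
        refine ⟨⟨⟨h1, by nlinarith⟩, h3⟩, ?_⟩
        rw [Nat.le_div_iff_mul_le h1]; rwa [mul_comm]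
    rw [hset, Finset.card_filter, Finset.sum_Ico_eq_sum_range, Nat.cast_sum]
    simp only [Nat.add_sub_cancel]
    refine Finset.sum_congr rfl fun n hn => ?_
    rw [Finset.mem_range, Nat.lt_iff_add_one_le, Nat.le_div_iff_mul_le hdK] at hn
    have hX : n + 1 ≤ X := by nlinarith
    rw [add_comm 1 n, ite_dvd_eq _ _ (Nat.div_pos hX (Nat.succ_pos n)),
      Nat.div_div_eq_div_mul, ← Nat.div_div_eq_div_mul (X - (n + 1)),
      show (X - (n + 1)) / (n + 1) = X / (n + 1) - 1 by simpa using Nat.sub_mul_div X (n + 1) 1]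

/-- The zeros in `+ 0` and `- 0` give all four sums the shape of `abs_sum_sawtooth_hyperbola_le`,
with shifts (s, c) equal to (0, 0), (1/d, 0), (0, 0) and (0, 1/d). -/
theorem countDvdDiv_eq_sawtooth (X d K : ℕ) (hd : 1 ≤ d) (hK : 1 ≤ K) :
    (countDvdDiv X d : ℝ) =
      X * ∑ e ∈ Finset.range (K - 1), 1 / (((d : ℝ) * (e + 1)) * (d * (e + 1) + 1))
      + ((X / (d * K) : ℕ) : ℝ) / d
      - ∑ e ∈ Finset.range (K - 1), sawtooth ((X : ℝ) / d / (e + 1 + 0) - 0)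
      + ∑ e ∈ Finset.range (K - 1), sawtooth ((X : ℝ) / d / (e + 1 + 1 / d) - 0)
      - ∑ n ∈ Finset.range (X / (d * K)), sawtooth ((X : ℝ) / d / (n + 1 + 0) - 0)
      + ∑ n ∈ Finset.range (X / (d * K)), sawtooth ((X : ℝ) / d / (n + 1 + 0) - 1 / d) := by
  have hd0 : (0 : ℝ) < d := by exact_mod_cast hd
  have hdK : 0 < d * K := by positivity
  rw [countDvdDiv_eq X d K hd hK]
  have e1 : ∀ e : ℕ, ((X / (d * (e + 1)) : ℕ) : ℝ) - ((X / (d * (e + 1) + 1) : ℕ) : ℝ) =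
      X * (1 / (((d : ℝ) * (e + 1)) * (d * (e + 1) + 1)))
        - sawtooth ((X : ℝ) / d / (e + 1 + 0) - 0)
        + sawtooth ((X : ℝ) / d / (e + 1 + 1 / d) - 0) := by
    intro e
    rw [Nat.cast_div_eq_sub_sawtooth, Nat.cast_div_eq_sub_sawtooth]
    push_cast
    rw [show (X : ℝ) / d / (e + 1 + 0) - 0 = X / (d * (e + 1)) by field_simp; ring,
      show (X : ℝ) / d / (e + 1 + 1 / d) - 0 = X / (d * (e + 1) + 1) by field_simp; ring]
    have : (d : ℝ) * (e + 1) + 1 ≠ 0 := by positivity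
    field_simp
    ring
  have e2 : ∀ n ∈ Finset.range (X / (d * K)),
      ((X / ((n + 1) * d) : ℕ) : ℝ) - (((X - (n + 1)) / ((n + 1) * d) : ℕ) : ℝ) =
      1 / d - sawtooth ((X : ℝ) / d / (n + 1 + 0) - 0)
        + sawtooth ((X : ℝ) / d / (n + 1 + 0) - 1 / d) := by
    intro n hn
    rw [Finset.mem_range, Nat.lt_iff_add_one_le, Nat.le_div_iff_mul_le hdK] at hn
    have hX : n + 1 ≤ X := by nlinarith
    rw [Nat.cast_div_eq_sub_sawtooth, Nat.cast_div_eq_sub_sawtooth, Nat.cast_sub hX]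
    push_cast
    rw [show (X : ℝ) / d / (n + 1 + 0) - 0 = X / ((n + 1) * d) by field_simp; ring,
      show (X : ℝ) / d / (n + 1 + 0) - 1 / d = (X - (n + 1)) / ((n + 1) * d) by
        field_simp; ring]
    field_simp
    ring
  rw [Finset.sum_congr rfl fun e _ => e1 e, Finset.sum_congr rfl e2]
  simp only [Finset.sum_add_distrib, Finset.sum_sub_distrib, Finset.sum_const, Finset.card_range,
    nsmul_eq_mul, ← Finset.mul_sum]
  ring

/-! ### The density and its tail -/

/-- Telescoping, from dt(dt + 1) ≥ d²(t - 1/2)(t + 1/2). The lower bound that follows telescopes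
from dt(dt + 1) ≤ d²t(t + 1), which uses d ≥ 1. -/
theorem sum_range_dvdDivDensity_tail_le {d K : ℕ} (hd : 1 ≤ d) (hK : 1 ≤ K) (M : ℕ) :
    ∑ e ∈ Finset.range M, 1 / (((d : ℝ) * (e + K)) * (d * (e + K) + 1))
      ≤ 1 / (d ^ 2 * (K - 1 / 2)) - 1 / (d ^ 2 * (M + K - 1 / 2)) := by
  have hd0 : (0 : ℝ) < d := by exact_mod_cast hd
  have hK0 : (1 : ℝ) ≤ K := by exact_mod_cast hK
  induction M with
  | zero => simp
  | succ M ih =>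
    rw [Finset.sum_range_succ]
    have hM : (0 : ℝ) ≤ M := Nat.cast_nonneg M
    set t : ℝ := M + K with ht
    have ht1 : 1 ≤ t := by linarith
    have h : 1 / (((d : ℝ) * t) * (d * t + 1)) ≤
        1 / (d ^ 2 * (t - 1 / 2)) - 1 / (d ^ 2 * (t + 1 - 1 / 2)) := by
      have h1 : 0 < t - 1 / 2 := by linarith
      have h2 : 0 < t + 1 - 1 / 2 := by linarith
      have e : 1 / ((d : ℝ) ^ 2 * (t - 1 / 2)) - 1 / (d ^ 2 * (t + 1 - 1 / 2))
          = 1 / (d ^ 2 * ((t - 1 / 2) * (t + 1 - 1 / 2))) := by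
        rw [div_sub_div _ _ (by positivity) (by positivity),
          div_eq_div_iff (by positivity) (by positivity)]
        ring
      rw [e]
      refine one_div_le_one_div_of_le (by positivity) ?_
      nlinarith [mul_pos hd0 hd0, mul_pos hd0 (by linarith : 0 < t)]
    have e3 : ((M + 1 : ℕ) : ℝ) + K - 1 / 2 = t + 1 - 1 / 2 := by push_cast; rw [ht]; ring
    rw [e3]
    linarith

theorem le_sum_range_dvdDivDensity_tail {d K : ℕ} (hd : 1 ≤ d) (hK : 1 ≤ K) (M : ℕ) :
    1 / (d ^ 2 * K) - 1 / (d ^ 2 * (M + K))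
      ≤ ∑ e ∈ Finset.range M, 1 / (((d : ℝ) * (e + K)) * (d * (e + K) + 1)) := by
  have hd0 : (1 : ℝ) ≤ d := by exact_mod_cast hd
  have hK0 : (1 : ℝ) ≤ K := by exact_mod_cast hK
  induction M with
  | zero => simp
  | succ M ih =>
    rw [Finset.sum_range_succ]
    have hM : (0 : ℝ) ≤ M := Nat.cast_nonneg M
    set t : ℝ := M + K with ht
    have ht1 : 1 ≤ t := by linarith
    have h : 1 / (d ^ 2 * t) - 1 / (d ^ 2 * (t + 1)) ≤ 1 / (((d : ℝ) * t) * (d * t + 1)) := by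
      have e : 1 / ((d : ℝ) ^ 2 * t) - 1 / (d ^ 2 * (t + 1))
          = 1 / (d ^ 2 * (t * (t + 1))) := by
        have : t ≠ 0 := by positivity
        have : t + 1 ≠ 0 := by positivity
        field_simp; ring
      rw [e]
      refine one_div_le_one_div_of_le (by positivity) ?_
      nlinarith [mul_nonneg (by linarith : 0 ≤ (d : ℝ)) (by linarith : 0 ≤ t)]
    have e3 : ((M + 1 : ℕ) : ℝ) + K = t + 1 := by push_cast; rw [ht]; ring
    rw [e3]
    linarith

theorem summable_dvdDivDensity {d : ℕ} (hd : 1 ≤ d) :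
    Summable fun e : ℕ => 1 / (((d : ℝ) * (e + 1)) * (d * (e + 1) + 1)) := by
  refine summable_of_sum_range_le (c := 1 / (d ^ 2 * ((1 : ℕ) - 1 / 2)))
    (fun e => by positivity) fun M => ?_
  have := sum_range_dvdDivDensity_tail_le hd le_rfl M
  refine le_trans (le_of_eq (by simp)) (this.trans ?_)
  have : 0 ≤ 1 / ((d : ℝ) ^ 2 * (M + (1 : ℕ) - 1 / 2)) := by
    have : (0 : ℝ) ≤ (M + (1 : ℕ) - 1 / 2) := by
      have : (0 : ℝ) ≤ M := Nat.cast_nonneg M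
      push_cast; linarith
    positivity
  linarith

/-- The tail of the density matches the term ⌊X/(dK)⌋/d that the large quotients contribute to the
count. -/
theorem abs_dvdDivDensity_sub_le {d K : ℕ} (hd : 1 ≤ d) (hK : 1 ≤ K) :
    |dvdDivDensity d - ∑ e ∈ Finset.range (K - 1), 1 / (((d : ℝ) * (e + 1)) * (d * (e + 1) + 1))
      - 1 / (d ^ 2 * K)| ≤ 1 / ((d : ℝ) * K) ^ 2 := by
  have hd0 : (0 : ℝ) < d := by exact_mod_cast hd
  have hK0 : (1 : ℝ) ≤ K := by exact_mod_cast hK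
  have hs := summable_dvdDivDensity hd
  have h1 := hs.sum_add_tsum_nat_add (K - 1)
  have htail : ∀ e : ℕ, 1 / (((d : ℝ) * ((e + (K - 1) : ℕ) + 1)) * (d * ((e + (K - 1) : ℕ) + 1) + 1))
      = 1 / (((d : ℝ) * (e + K)) * (d * (e + K) + 1)) := fun e => by
    rw [show (((e + (K - 1) : ℕ) : ℝ) + 1) = e + K by
      push_cast [Nat.cast_sub hK]; ring]
  rw [tsum_congr htail] at h1
  have hs2 : Summable fun e : ℕ => 1 / (((d : ℝ) * (e + K)) * (d * (e + K) + 1)) := by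
    have := (summable_nat_add_iff (K - 1)).2 hs
    exact this.congr htail
  set t := ∑' e : ℕ, 1 / (((d : ℝ) * (e + K)) * (d * (e + K) + 1)) with ht
  have hup : t ≤ 1 / (d ^ 2 * (K - 1 / 2)) := by
    refine Real.tsum_le_of_sum_range_le (fun e => by positivity) fun M => ?_
    refine (sum_range_dvdDivDensity_tail_le hd hK M).trans ?_
    have : 0 ≤ 1 / ((d : ℝ) ^ 2 * (M + K - 1 / 2)) := by
      have : (0 : ℝ) ≤ (M + K - 1 / 2) := by
        have : (0 : ℝ) ≤ M := Nat.cast_nonneg M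
        linarith
      positivity
    linarith
  have hlo : 1 / ((d : ℝ) ^ 2 * K) ≤ t := by
    refine le_of_tendsto_of_tendsto' (f := fun M : ℕ => 1 / ((d : ℝ) ^ 2 * K)
      - 1 / (d ^ 2 * (M + K))) (b := atTop) ?_ hs2.hasSum.tendsto_sum_nat
      (le_sum_range_dvdDivDensity_tail hd hK)
    have h0 : Tendsto (fun M : ℕ => 1 / ((d : ℝ) ^ 2 * (M + K))) atTop (nhds 0) := by
      refine tendsto_const_nhds.div_atTop ?_
      exact (tendsto_atTop_add_const_right _ _ tendsto_natCast_atTop_atTop).const_mul_atTop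
        (by positivity)
    have h3 := h0.const_sub (1 / ((d : ℝ) ^ 2 * K))
    rwa [sub_zero] at h3
  have hdiff : 1 / ((d : ℝ) ^ 2 * (K - 1 / 2)) - 1 / (d ^ 2 * K) ≤ 1 / ((d : ℝ) * K) ^ 2 := by
    have h2 : (0 : ℝ) < K - 1 / 2 := by linarith
    have e : 1 / ((d : ℝ) ^ 2 * (K - 1 / 2)) - 1 / (d ^ 2 * K)
        = 1 / (d ^ 2 * (2 * (K * (K - 1 / 2)))) := by
      rw [div_sub_div _ _ (by positivity) (by positivity),
        div_eq_div_iff (by positivity) (by positivity)]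
      ring
    rw [e]
    refine one_div_le_one_div_of_le (by positivity) ?_
    rw [mul_pow]
    gcongr
    nlinarith
  have e : dvdDivDensity d - ∑ e ∈ Finset.range (K - 1), 1 / (((d : ℝ) * (e + 1)) * (d * (e + 1) + 1))
      = t := by rw [dvdDivDensity, ← h1]; ring
  rw [e, abs_of_nonneg (by linarith)]
  linarith

theorem dvdDivDensity_nonneg (d : ℕ) : 0 ≤ dvdDivDensity d :=
  tsum_nonneg fun e => by positivity

theorem dvdDivDensity_le {d : ℕ} (hd : 1 ≤ d) : dvdDivDensity d ≤ 2 / (d : ℝ) ^ 2 := by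
  have h := (abs_le.1 (abs_dvdDivDensity_sub_le hd le_rfl)).2
  simp only [Nat.sub_self, Finset.range_zero, Finset.sum_empty, Nat.cast_one, mul_one] at h
  have : 2 / (d : ℝ) ^ 2 = 1 / d ^ 2 + 1 / d ^ 2 := by ring
  linarith

/-! ### The error term for a single d -/

/-- The count with its main term removed, when the divisors are split at the height `B`. -/
theorem abs_countDvdDiv_sub_le {X d K : ℕ} {B : ℝ} (hd : 1 ≤ d) (hB : 0 < B) (hXB : X ≤ B ^ 2)
    (hK : B ≤ d * K) {V : ℝ}
    (h1 : |∑ e ∈ Finset.range (K - 1), sawtooth ((X : ℝ) / d / (e + 1 + 0) - 0)| ≤ V)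
    (h2 : |∑ e ∈ Finset.range (K - 1), sawtooth ((X : ℝ) / d / (e + 1 + 1 / d) - 0)| ≤ V)
    (h3 : |∑ n ∈ Finset.range (X / (d * K)), sawtooth ((X : ℝ) / d / (n + 1 + 0) - 0)| ≤ V)
    (h4 : |∑ n ∈ Finset.range (X / (d * K)), sawtooth ((X : ℝ) / d / (n + 1 + 0) - 1 / d)| ≤ V) :
    |countDvdDiv X d - X * dvdDivDensity d| ≤ 4 * V + 2 := by
  have hd0 : (1 : ℝ) ≤ d := by exact_mod_cast hd
  have hK1 : 1 ≤ K := by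
    rcases Nat.eq_zero_or_pos K with rfl | h
    · simp at hK; linarith
    · exact h
  have hK0 : (1 : ℝ) ≤ K := by exact_mod_cast hK1
  rw [countDvdDiv_eq_sawtooth X d K hd hK1]
  have hc := abs_dvdDivDensity_sub_le hd hK1
  have hX0 : (0 : ℝ) ≤ X := Nat.cast_nonneg X
  -- Cutting the density at dK ≥ B ≥ √X costs at most 1; rounding in ⌊X/(dK)⌋/d costs at most
  -- another 1.
  have hc2 : (X : ℝ) * (1 / ((d : ℝ) * K) ^ 2) ≤ 1 := by
    rw [mul_one_div, div_le_one (by positivity)]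
    exact hXB.trans (by gcongr)
  have hc3 : |X * (dvdDivDensity d - ∑ e ∈ Finset.range (K - 1),
      1 / (((d : ℝ) * (e + 1)) * (d * (e + 1) + 1)) - 1 / (d ^ 2 * K))| ≤ 1 := by
    rw [abs_mul, abs_of_nonneg hX0]
    exact (mul_le_mul_of_nonneg_left hc hX0).trans hc2
  have hf : |((X / (d * K) : ℕ) : ℝ) / d - X * (1 / (d ^ 2 * K))| ≤ 1 := by
    rw [Nat.cast_div_eq_sub_sawtooth]
    have e : ((X : ℝ) / (d * K : ℕ) - 1 / 2 - sawtooth ((X : ℝ) / (d * K : ℕ))) / d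
        - X * (1 / (d ^ 2 * K)) = (- 1 / 2 - sawtooth ((X : ℝ) / (d * K : ℕ))) / d := by
      push_cast; field_simp; ring
    rw [e, abs_div, abs_of_pos (by linarith : (0 : ℝ) < d), div_le_one (by linarith)]
    have := abs_le.1 (abs_sawtooth_le ((X : ℝ) / (d * K : ℕ)))
    refine le_trans ?_ hd0
    rw [abs_le]; constructor <;> linarith [this.1, this.2]
  rw [abs_le] at *
  constructor <;> linarith [h1.1, h1.2, h2.1, h2.2, h3.1, h3.2, h4.1, h4.2, hc3.1, hc3.2, hf.1, hf.2]

theorem mul_sqrt_le_sq {r z : ℝ} (hr : 0 ≤ r) (h : r ^ 3 ≤ z ^ 4) : r * √r ≤ z ^ 2 := by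
  refine (pow_le_pow_iff_left₀ (by positivity) (by positivity) two_ne_zero).1 ?_
  calc (r * √r) ^ 2 = r ^ 2 * √r ^ 2 := by ring
    _ = r ^ 3 := by rw [Real.sq_sqrt hr]; ring
    _ ≤ (z ^ 2) ^ 2 := by rw [← pow_mul]; exact h

/-- In the application z = X^{1/6}, so the target (N/w)^{3/2} ≤ X^{1/3} reads (N/w)³ ≤ z⁴. -/
theorem abs_sum_sawtooth_hyperbola_le_of_cube_le {X N : ℕ} {w z s r : ℝ} (c : ℝ) (hw : 0 < w)
    (hs0 : 0 ≤ s) (hs1 : s ≤ 1) (hNX : N ≤ X) (hr : N / w ≤ r) (hr3 : r ^ 3 ≤ z ^ 4) :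
    |∑ n ∈ Finset.range N, sawtooth (w ^ 3 / (n + 1 + s) - c)|
      ≤ 4000 * w * (Nat.log 2 X + 1) + 60000 * z ^ 2 := by
  have h := abs_sum_sawtooth_hyperbola_le c hw hs0 hs1 (Nat.log 2 X + 1) N
    (hNX.trans_lt (Nat.lt_pow_succ_log_self (by norm_num) X))
  have h0 : 0 ≤ N / w := by positivity
  have h1 : N / w * √(N / w) ≤ z ^ 2 :=
    mul_sqrt_le_sq h0 ((pow_le_pow_left₀ h0 hr 3).trans hr3)
  push_cast at h
  linarith

/-- The error in counting the `n ≤ X` with `d ∣ ⌊X / n⌋`, for `X = z⁶` and `d = v³`. -/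
theorem abs_countDvdDiv_sub_le_pow {X d : ℕ} {z v : ℝ} (hX : 1 ≤ X) (hd : 1 ≤ d)
    (hz0 : 0 < z) (hv0 : 0 < v) (hz : z ^ 6 = X) (hv : v ^ 3 = d) :
    |countDvdDiv X d - X * dvdDivDensity d|
      ≤ 16000 * (z ^ 2 / v) * (Nat.log 2 X + 1) + 240002 * z ^ 2 := by
  have hd1 : (1 : ℝ) ≤ d := by exact_mod_cast hd
  have hX1 : (1 : ℝ) ≤ X := by exact_mod_cast hX
  have hd0 : (0 : ℝ) < d := by linarith
  have hz1 : 1 ≤ z := by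
    rw [← hz] at hX1; exact (one_le_pow_iff_of_nonneg hz0.le (by norm_num)).1 hX1
  have hv1 : 1 ≤ v := by
    rw [← hv] at hd1; exact (one_le_pow_iff_of_nonneg hv0.le (by norm_num)).1 hd1
  set w : ℝ := z ^ 2 / v with hw
  have hw0 : 0 < w := by positivity
  have hw3 : (X : ℝ) / d = w ^ 3 := by rw [← hz, ← hv, hw, div_pow]; ring
  have hdiv : 1 / (d : ℝ) ≤ 1 := by rw [div_le_one hd0]; exact hd1
  have hdiv0 : 0 ≤ 1 / (d : ℝ) := by positivity
  set V : ℝ := 4000 * w * (Nat.log 2 X + 1) + 60000 * z ^ 2 with hV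
  have hz2 : 1 ≤ z ^ 2 := one_le_pow₀ hz1
  -- The sums over e have length at most B/d, those over n at most z⁶/B; K is the least integer with
  -- dK ≥ B.
  have main : ∀ B : ℝ, z ^ 3 ≤ B → B ≤ z ^ 6 →
      (∃ r, B / d / w ≤ r ∧ r ^ 3 ≤ z ^ 4) →
      (∀ N : ℕ, N ≤ X → N ≤ z ^ 6 / B → ∀ c : ℝ,
        |∑ n ∈ Finset.range N, sawtooth (w ^ 3 / (n + 1 + 0) - c)| ≤ V) →
      |countDvdDiv X d - X * dvdDivDensity d| ≤ 4 * V + 2 := by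
    rintro B hB1 hB2 ⟨r, hr, hr3⟩ hN0
    have hB0 : 0 < B := lt_of_lt_of_le (by positivity) hB1
    have hK0 : 1 ≤ ⌈B / d⌉₊ := Nat.one_le_ceil_iff.2 (by positivity)
    have hK : B ≤ d * ⌈B / d⌉₊ := by
      have := Nat.le_ceil (B / d)
      rwa [div_le_iff₀ hd0, mul_comm] at this
    have hKu : ((⌈B / d⌉₊ - 1 : ℕ) : ℝ) ≤ B / d := by
      rw [Nat.cast_sub hK0]
      have := Nat.ceil_lt_add_one (by positivity : 0 ≤ B / d)
      push_cast; linarith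
    have hKX : ⌈B / d⌉₊ - 1 ≤ X := by
      have h1 : B / d ≤ X := (div_le_self hB0.le hd1).trans (hB2.trans hz.le)
      exact_mod_cast hKu.trans h1
    have hr' : ((⌈B / d⌉₊ - 1 : ℕ) : ℝ) / w ≤ r := le_trans (by gcongr) hr
    have hNX : X / (d * ⌈B / d⌉₊) ≤ X := Nat.div_le_self _ _
    have hNB : ((X / (d * ⌈B / d⌉₊) : ℕ) : ℝ) ≤ z ^ 6 / B := by
      refine Nat.cast_div_le.trans ?_
      rw [hz]; push_cast; gcongr
    refine abs_countDvdDiv_sub_le hd hB0 ?_ hK ?_ ?_ ?_ ?_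
    · rw [← hz, show z ^ 6 = (z ^ 3) ^ 2 by ring]; gcongr
    all_goals rw [hw3]
    · exact abs_sum_sawtooth_hyperbola_le_of_cube_le 0 hw0 le_rfl zero_le_one hKX hr' hr3
    · exact abs_sum_sawtooth_hyperbola_le_of_cube_le 0 hw0 hdiv0 hdiv hKX hr' hr3
    · exact hN0 _ hNX hNB _
    · exact hN0 _ hNX hNB _
  have hfin : |countDvdDiv X d - X * dvdDivDensity d| ≤ 4 * V + 2 := by
    -- For d ≤ z take B = √X = z³: the ratio N/w is at most z/v² ≤ z over e and at most zv over n,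
    -- and (zv)³ = z³d ≤ z⁴. For d > z take B = z⁴: over e the cube of the ratio is at most z⁶/d² ≤
    -- z⁴, and over n at most z² terms remain, so the trivial bound is enough.
    rcases le_or_gt (d : ℝ) z with hdz | hdz
    · refine main (z ^ 3) le_rfl (pow_le_pow_right₀ hz1 (by norm_num)) ⟨z, ?_, ?_⟩ ?_
      · rw [← hv, hw, show z ^ 3 / v ^ 3 / (z ^ 2 / v) = z / v ^ 2 by field_simp]
        exact div_le_self hz0.le (one_le_pow₀ hv1)
      · exact pow_le_pow_right₀ hz1 (by norm_num)
      · intro N hNX hN c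
        refine abs_sum_sawtooth_hyperbola_le_of_cube_le (r := z * v) c hw0 le_rfl zero_le_one hNX
          ?_ ?_
        · rw [div_le_iff₀ hw0, hw]
          refine hN.trans (le_of_eq ?_)
          field_simp
        · rw [mul_pow, hv]
          calc z ^ 3 * d ≤ z ^ 3 * z := by gcongr
            _ = z ^ 4 := by ring
    · refine main (z ^ 4) (pow_le_pow_right₀ hz1 (by norm_num))
        (pow_le_pow_right₀ hz1 (by norm_num)) ⟨z ^ 2 / v ^ 2, ?_, ?_⟩ ?_
      · rw [← hv, hw]; exact le_of_eq (by field_simp)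
      · rw [← hv] at hdz
        rw [div_pow, div_le_iff₀ (by positivity)]
        calc (z ^ 2) ^ 3 = z ^ 4 * z ^ 2 := by ring
          _ ≤ z ^ 4 * (v ^ 3) ^ 2 := by gcongr
          _ = _ := by ring
      · intro N _ hN c
        have h1 := abs_sum_sawtooth_le_card (fun n : ℕ => w ^ 3 / (n + 1 + 0) - c) (Finset.range N)
        rw [Finset.card_range] at h1
        have h2 : z ^ 6 / z ^ 4 = z ^ 2 := by field_simp
        rw [h2] at hN
        have : 0 ≤ 4000 * w * (Nat.log 2 X + 1) := by positivity
        rw [hV]; linarith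
  rw [hV] at hfin
  linarith

/-! ### Reduction to the counts, and the leading coefficient -/

theorem integralPartSum_eq (f : ℕ → ℂ) (x : ℝ) :
    integralPartSum f x = ∑ n ∈ Finset.Icc 1 ⌊x⌋₊, f (⌊x⌋₊ / n) / ((⌊x⌋₊ / n : ℕ) : ℂ) := by
  rw [integralPartSum]
  exact Finset.sum_congr rfl fun n _ => by rw [Nat.floor_div_natCast]

theorem id_mul_apply_div (g : ArithmeticFunction ℂ) (m : ℕ) :
    ((ArithmeticFunction.id : ArithmeticFunction ℂ) * g) m / (m : ℂ)
      = ∑ d ∈ m.divisors, g d / d := by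
  rw [ArithmeticFunction.mul_apply, Finset.sum_div,
    ← Nat.sum_divisorsAntidiagonal' (f := fun _ d => g d / (d : ℂ))]
  refine Finset.sum_congr rfl fun p hp => ?_
  obtain ⟨h, h0⟩ := Nat.mem_divisorsAntidiagonal.1 hp
  rw [← h] at h0 ⊢
  have h1 : (p.1 : ℂ) ≠ 0 := by exact_mod_cast left_ne_zero_of_mul h0
  have h2 : (p.2 : ℂ) ≠ 0 := by exact_mod_cast right_ne_zero_of_mul h0
  simp only [ArithmeticFunction.natCoe_apply, ArithmeticFunction.id_apply]
  push_cast
  field_simp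

theorem integralPartSum_id_mul (g : ArithmeticFunction ℂ) (x : ℝ) :
    integralPartSum (fun n => ((ArithmeticFunction.id : ArithmeticFunction ℂ) * g) n) x
      = ∑ d ∈ Finset.Icc 1 ⌊x⌋₊, g d / d * countDvdDiv ⌊x⌋₊ d := by
  rw [integralPartSum_eq]
  have h : ∀ n ∈ Finset.Icc 1 ⌊x⌋₊,
      ((ArithmeticFunction.id : ArithmeticFunction ℂ) * g) (⌊x⌋₊ / n) / ((⌊x⌋₊ / n : ℕ) : ℂ)
      = ∑ d ∈ Finset.Icc 1 ⌊x⌋₊, if d ∣ ⌊x⌋₊ / n then g d / (d : ℂ) else 0 := by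
    intro n hn
    rw [Finset.mem_Icc] at hn
    have hpos : 1 ≤ ⌊x⌋₊ / n := Nat.div_pos hn.2 hn.1
    rw [id_mul_apply_div g, ← Finset.sum_filter]
    refine Finset.sum_congr ?_ fun _ _ => rfl
    ext d
    simp only [Nat.mem_divisors, Finset.mem_filter, Finset.mem_Icc]
    constructor
    · rintro ⟨h1, h2⟩
      exact ⟨⟨Nat.pos_of_dvd_of_pos h1 hpos,
        (Nat.le_of_dvd hpos h1).trans (Nat.div_le_self _ _)⟩, h1⟩
    · rintro ⟨_, h1⟩
      exact ⟨h1, by omega⟩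
  rw [Finset.sum_congr rfl h, Finset.sum_comm]
  refine Finset.sum_congr rfl fun d _ => ?_
  rw [← Finset.sum_filter, Finset.sum_const, nsmul_eq_mul, countDvdDiv, mul_comm]

theorem countDvdDiv_eq_zero {X d : ℕ} (h : X < d) : countDvdDiv X d = 0 := by
  rw [countDvdDiv, Finset.card_eq_zero, Finset.filter_eq_empty_iff]
  intro n hn hdvd
  rw [Finset.mem_Icc] at hn
  have := Nat.le_of_dvd (Nat.div_pos hn.2 hn.1) hdvd
  have := Nat.div_le_self X n
  omega

/-- The summand of the double series over `m = de` for the leading coefficient. -/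
noncomputable def mainTermPair (g : ℕ → ℂ) (p : ℕ+ × ℕ+) : ℂ :=
  g p.1 / (p.1 : ℂ) * (1 / (((p.1 : ℂ) * p.2) * (p.1 * p.2 + 1)))

/-- The term at (d, e) is at most C/(d²e²). This absolute convergence justifies both groupings of
the double series. -/
theorem summable_norm_mainTermPair {g : ℕ → ℂ} {C : ℝ} (hg : ∀ n : ℕ, 1 ≤ n → ‖g n‖ ≤ C) :
    Summable fun p => ‖mainTermPair g p‖ := by
  have hC : 0 ≤ C := (norm_nonneg _).trans (hg 1 le_rfl)
  have h2 : Summable fun n : ℕ+ => 1 / ((n : ℕ) : ℝ) ^ 2 :=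
    (Real.summable_one_div_nat_pow.2 one_lt_two).comp_injective PNat.coe_injective
  have h3 := (h2.mul_of_nonneg h2 (fun _ => by positivity) (fun _ => by positivity)).mul_left C
  refine Summable.of_nonneg_of_le (fun _ => norm_nonneg _) (fun p => ?_) h3
  obtain ⟨d, e⟩ := p
  have hd : (1 : ℝ) ≤ (d : ℕ) := by exact Nat.one_le_cast.2 d.pos
  have he : (1 : ℝ) ≤ (e : ℕ) := by exact Nat.one_le_cast.2 e.pos
  have e1 : ‖((d : ℕ) : ℂ) * (e : ℕ) + 1‖ = (d : ℕ) * (e : ℕ) + 1 := by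
    rw [show ((d : ℕ) : ℂ) * (e : ℕ) + 1 = (((d : ℕ) * (e : ℕ) + 1 : ℝ) : ℂ) by push_cast; rfl,
      Complex.norm_real, Real.norm_eq_abs, abs_of_pos (by positivity)]
  simp only [mainTermPair]
  rw [norm_mul, norm_div, norm_div, norm_mul, norm_mul, e1, norm_one, Complex.norm_natCast,
    Complex.norm_natCast]
  calc ‖g d‖ / ((d : ℕ) : ℝ) * (1 / ((d : ℕ) * (e : ℕ) * ((d : ℕ) * (e : ℕ) + 1)))
      ≤ C * (1 / ((d : ℕ) * (e : ℕ) * ((d : ℕ) * (e : ℕ)))) := by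
        gcongr
        · exact (div_le_self (norm_nonneg _) hd).trans (hg d d.pos)
        · linarith
    _ = C * (1 / ((d : ℕ) : ℝ) ^ 2 * (1 / ((e : ℕ) : ℝ) ^ 2)) := by field_simp

theorem mainTerm_eq_sum_mainTermPair (g : ArithmeticFunction ℂ) (n : ℕ+) :
    mainTerm (fun n => ((ArithmeticFunction.id : ArithmeticFunction ℂ) * g) n) n
      = ∑' x : Nat.divisorsAntidiagonal n,
        mainTermPair g (sigmaAntidiagonalEquivProd ⟨n, x⟩) := by
  have e : mainTerm (fun n => ((ArithmeticFunction.id : ArithmeticFunction ℂ) * g) n) n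
      = (((ArithmeticFunction.id : ArithmeticFunction ℂ) * g) n / ((n : ℕ) : ℂ))
        * (1 / ((n : ℕ) * ((n : ℕ) + 1))) := by
    rw [mainTerm, sq, mul_assoc, ← div_div, div_eq_mul_one_div (_ / _)]
  rw [e, id_mul_apply_div g, ← Nat.sum_divisorsAntidiagonal (f := fun d _ => g d / (d : ℂ)),
    Finset.sum_mul, tsum_fintype, ← Finset.sum_coe_sort]
  refine Finset.sum_congr rfl fun x _ => ?_
  have hx : ((n : ℕ) : ℂ) = (x.1.1 : ℂ) * x.1.2 := by
    rw [← Nat.cast_mul, (Nat.mem_divisorsAntidiagonal.1 x.2).1]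
  simp only [mainTermPair, sigmaAntidiagonalEquivProd, divisorsAntidiagonalFactors,
    Equiv.coe_fn_mk, PNat.mk_coe]
  rw [hx]

theorem summable_mainTerm {g : ArithmeticFunction ℂ} {C : ℝ}
    (hg : ∀ n : ℕ, 1 ≤ n → ‖g n‖ ≤ C) :
    Summable (mainTerm fun n => ((ArithmeticFunction.id : ArithmeticFunction ℂ) * g) n) := by
  have h := (sigmaAntidiagonalEquivProd.summable_iff.2 (summable_norm_mainTermPair hg).of_norm).sigma
  rw [← PNat.coe_injective.summable_iff (f := mainTerm _)]
  · exact h.congr fun n => (mainTerm_eq_sum_mainTermPair g n).symm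
  · intro m hm
    obtain rfl : m = 0 := by
      by_contra h0
      exact hm ⟨⟨m, Nat.pos_of_ne_zero h0⟩, rfl⟩
    simp [mainTerm]

/-- Grouping the double series by the product m = de gives the leading coefficient; grouping by d
gives the densities. -/
theorem hasSum_density {g : ArithmeticFunction ℂ} {C : ℝ} (hg : ∀ n : ℕ, 1 ≤ n → ‖g n‖ ≤ C) :
    HasSum (fun d : ℕ => g d / d * dvdDivDensity d)
      (∑' m, mainTerm (fun n => ((ArithmeticFunction.id : ArithmeticFunction ℂ) * g) n) m) := by
  set F := mainTerm (fun n => ((ArithmeticFunction.id : ArithmeticFunction ℂ) * g) n) with hF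
  have hs := (summable_norm_mainTermPair hg).of_norm
  have h1 : ∑' p, mainTermPair g p = ∑' m, F m := by
    have hz : ∀ m, m ∉ Set.range ((↑) : ℕ+ → ℕ) → F m = 0 := by
      intro m hm
      obtain rfl : m = 0 := by
        by_contra h0
        exact hm ⟨⟨m, Nat.pos_of_ne_zero h0⟩, rfl⟩
      simp [hF, mainTerm]
    have h2 : ∑' n : ℕ+, F n = ∑' m, F m :=
      PNat.coe_injective.tsum_eq fun m hm => by_contra fun h => hm (hz m h)
    have h3 := (sigmaAntidiagonalEquivProd.summable_iff.2 hs).tsum_sigma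
    rw [← h2, ← sigmaAntidiagonalEquivProd.tsum_eq]
    refine h3.trans ?_
    exact tsum_congr fun n => (mainTerm_eq_sum_mainTermPair g n).symm
  rw [← h1]
  rw [← PNat.coe_injective.hasSum_iff]
  · have h3 := hs.hasSum.prod_fiberwise fun d => (hs.prod_factor d).hasSum
    suffices h : ∀ d : ℕ+, g d / (d : ℂ) * dvdDivDensity d = ∑' e, mainTermPair g (d, e) by
      rw [← funext h] at h3
      exact h3
    intro d
    simp only [mainTermPair, tsum_mul_left]
    congr 1
    -- The density is indexed by naturals through e + 1, the pairs by positive integers.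
    rw [dvdDivDensity, Complex.ofReal_tsum, ← Equiv.pnatEquivNat.tsum_eq]
    refine tsum_congr fun e => ?_
    have : ((Equiv.pnatEquivNat e : ℕ) : ℂ) + 1 = ((e : ℕ) : ℂ) := by
      exact_mod_cast (by simp : e.natPred + 1 = (e : ℕ))
    push_cast
    rw [this]
  · intro m hm
    obtain rfl : m = 0 := by
      by_contra h0
      exact hm ⟨⟨m, Nat.pos_of_ne_zero h0⟩, rfl⟩
    simp

/-! ### Summing the errors over d -/

theorem sum_Icc_inv_le (X : ℕ) : ∑ d ∈ Finset.Icc 1 X, 1 / (d : ℝ) ≤ 1 + Real.log X := by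
  refine le_trans (le_of_eq ?_) (harmonic_le_one_add_log X)
  rw [harmonic_eq_sum_Icc]
  push_cast
  simp

/-- The three terms come from the error X^{1/3} weighted by 1/d, the error (X/d)^{1/3} log X
weighted by 1/d, and the densities with d > X. -/
theorem norm_integralPartSum_sub_le {g : ArithmeticFunction ℂ} {C : ℝ}
    (hg : ∀ n : ℕ, 1 ≤ n → ‖g n‖ ≤ C) {x : ℝ} (hx : 1 ≤ x) :
    ‖integralPartSum (fun n => ((ArithmeticFunction.id : ArithmeticFunction ℂ) * g) n) x
      - (⌊x⌋₊ : ℂ) * ∑' m, mainTerm (fun n => ((ArithmeticFunction.id : ArithmeticFunction ℂ) * g) n) m‖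
      ≤ C * (240002 * x ^ ((1 : ℝ) / 3) * (1 + Real.log x)
        + 16000 * x ^ ((1 : ℝ) / 3) * (Nat.log 2 ⌊x⌋₊ + 1) * (∑' d : ℕ, 1 / (d : ℝ) ^ ((4 : ℝ) / 3))
        + 2 * ∑' d : ℕ, 1 / (d : ℝ) ^ 2) := by
  have hC : 0 ≤ C := (norm_nonneg _).trans (hg 1 le_rfl)
  set X := ⌊x⌋₊ with hX
  have hX1 : 1 ≤ X := (Nat.one_le_floor_iff x).2 hx
  have hX0 : (0 : ℝ) < X := by exact_mod_cast hX1
  have hXx : (X : ℝ) ≤ x := Nat.floor_le (by linarith)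
  set y := (X : ℝ) ^ ((1 : ℝ) / 3) with hy
  have hyx : y ≤ x ^ ((1 : ℝ) / 3) := Real.rpow_le_rpow hX0.le hXx (by norm_num)
  have hy0 : 0 < y := Real.rpow_pos_of_pos hX0 _
  have hfin : HasSum (fun d : ℕ => g d / d * countDvdDiv X d)
      (∑ d ∈ Finset.Icc 1 X, g d / d * countDvdDiv X d) := by
    refine hasSum_sum_of_ne_finset_zero fun d hd => ?_
    rw [Finset.mem_Icc, not_and_or, not_le, not_le] at hd
    rcases hd with hd | hd
    · obtain rfl : d = 0 := by omega
      simp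
    · rw [countDvdDiv_eq_zero hd]; simp
  have hdiff := hfin.sub ((hasSum_density hg).mul_left (X : ℂ))
  rw [integralPartSum_id_mul, ← hdiff.tsum_eq]
  -- The harmonic part of the majorant must be cut off at X, since ∑ 1/d diverges.
  have hA : HasSum (fun d : ℕ => if d ∈ Finset.Icc 1 X then 240002 * y * (1 / (d : ℝ)) else 0)
      (∑ d ∈ Finset.Icc 1 X, 240002 * y * (1 / (d : ℝ))) := by
    rw [← Finset.sum_filter_of_ne (s := Finset.Icc 1 X) (p := fun d => d ∈ Finset.Icc 1 X)
      (fun d hd _ => hd), Finset.sum_filter]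
    exact hasSum_sum_of_ne_finset_zero fun d hd => if_neg hd
  have hB := (Real.summable_one_div_nat_rpow.2 (by norm_num : (1 : ℝ) < 4 / 3)).hasSum.mul_left
    (16000 * y * (Nat.log 2 X + 1))
  have hD := (Real.summable_one_div_nat_pow.2 one_lt_two).hasSum.mul_left (2 : ℝ)
  have hmaj := ((hA.add hB).add hD).mul_left C
  refine (tsum_of_norm_bounded hmaj fun d => ?_).trans ?_
  · rcases Nat.eq_zero_or_pos d with rfl | hd
    · simp only [ArithmeticFunction.map_zero]
      simp only [zero_div, zero_mul, mul_zero, sub_zero, norm_zero]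
      refine mul_nonneg hC ?_
      simp
    have hd0 : (0 : ℝ) < d := by exact_mod_cast hd
    have e : g d / d * countDvdDiv X d - X * (g d / d * dvdDivDensity d)
        = g d * ((1 / (d : ℝ) * (countDvdDiv X d - X * dvdDivDensity d) : ℝ) : ℂ) := by
      push_cast; ring
    rw [e, norm_mul, Complex.norm_real, Real.norm_eq_abs, abs_mul, abs_of_pos (by positivity)]
    refine mul_le_mul (hg d hd) ?_ (by positivity) hC
    have p1 : 0 ≤ 16000 * y * (Nat.log 2 X + 1) * (1 / (d : ℝ) ^ ((4 : ℝ) / 3)) := by positivity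
    have p2 : 0 ≤ 2 * (1 / (d : ℝ) ^ 2) := by positivity
    by_cases hdX : d ≤ X
    · rw [if_pos (Finset.mem_Icc.2 ⟨hd, hdX⟩)]
      set z := (X : ℝ) ^ ((1 : ℝ) / 6) with hz
      set v := (d : ℝ) ^ ((1 : ℝ) / 3) with hv
      have hz6 : z ^ 6 = X := by
        rw [hz, ← Real.rpow_natCast, ← Real.rpow_mul hX0.le]; norm_num
      have hz2 : z ^ 2 = y := by
        rw [hz, hy, ← Real.rpow_natCast, ← Real.rpow_mul hX0.le]; norm_num
      have hv3 : v ^ 3 = d := by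
        rw [hv, ← Real.rpow_natCast, ← Real.rpow_mul hd0.le]; norm_num
      have hv4 : (d : ℝ) ^ ((4 : ℝ) / 3) = d * v := by
        rw [hv, show (4 : ℝ) / 3 = 1 + 1 / 3 by norm_num, Real.rpow_add hd0, Real.rpow_one]
      have hv0 : 0 < v := Real.rpow_pos_of_pos hd0 _
      have h := abs_countDvdDiv_sub_le_pow hX1 hd (Real.rpow_pos_of_pos hX0 _) hv0 hz6 hv3
      rw [hz2] at h
      calc 1 / (d : ℝ) * |countDvdDiv X d - X * dvdDivDensity d|
          ≤ 1 / (d : ℝ) * (16000 * (y / v) * (Nat.log 2 X + 1) + 240002 * y) := by gcongr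
        _ = 240002 * y * (1 / (d : ℝ))
            + 16000 * y * (Nat.log 2 X + 1) * (1 / (d : ℝ) ^ ((4 : ℝ) / 3)) := by
            rw [hv4]; field_simp; ring
        _ ≤ _ := by linarith
    -- For d > X the count is zero, and X times the density is at most d · 2/d².
    · rw [if_neg (by rw [Finset.mem_Icc]; omega)]
      have hXd : (X : ℝ) ≤ d := by exact_mod_cast (not_le.1 hdX).le
      rw [countDvdDiv_eq_zero (not_le.1 hdX), Nat.cast_zero, zero_sub, abs_neg,
        abs_of_nonneg (mul_nonneg hX0.le (dvdDivDensity_nonneg d))]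
      have h : 1 / (d : ℝ) * (X * dvdDivDensity d) ≤ 2 * (1 / (d : ℝ) ^ 2) := by
        calc 1 / (d : ℝ) * (X * dvdDivDensity d) ≤ 1 / (d : ℝ) * (d * (2 / (d : ℝ) ^ 2)) := by
              have := dvdDivDensity_le hd
              have := dvdDivDensity_nonneg d
              gcongr
          _ = _ := by field_simp
      linarith
  · rw [← Finset.mul_sum]
    have hlog : Real.log X ≤ Real.log x := Real.log_le_log hX0 hXx
    have h1 := sum_Icc_inv_le X
    have h2 : ∑ d ∈ Finset.Icc 1 X, 1 / (d : ℝ) ≤ 1 + Real.log x := by linarith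
    have h3 : 0 ≤ ∑' d : ℕ, 1 / (d : ℝ) ^ ((4 : ℝ) / 3) := tsum_nonneg fun d => by positivity
    have h4 : 0 ≤ 1 + Real.log x := by linarith [Real.log_nonneg hx]
    gcongr

theorem natLog_floor_add_one_le {x : ℝ} (hx : 1 ≤ Real.log x) (hx1 : 1 ≤ x) :
    (Nat.log 2 ⌊x⌋₊ : ℝ) + 1 ≤ 3 * Real.log x := by
  have hX1 : 1 ≤ ⌊x⌋₊ := (Nat.one_le_floor_iff x).2 hx1
  have h1 : (Nat.log 2 ⌊x⌋₊ : ℝ) ≤ Real.logb 2 ⌊x⌋₊ := by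
    exact_mod_cast Real.natLog_le_logb ⌊x⌋₊ 2
  have h2 : Real.log ⌊x⌋₊ ≤ Real.log x :=
    Real.log_le_log (by exact_mod_cast hX1) (Nat.floor_le (by linarith))
  have h3 : Real.logb 2 ⌊x⌋₊ ≤ 2 * Real.log x := by
    rw [Real.logb, div_le_iff₀ (Real.log_pos one_lt_two)]
    nlinarith [Real.log_two_gt_d9]
  linarith

/-- The asymptotic formula for the convolution of the identity with a bounded function. -/
theorem hasIntegralPartAsymptotic_id_mul {g : ArithmeticFunction ℂ} {C : ℝ}
    (hg : ∀ n : ℕ, 1 ≤ n → ‖g n‖ ≤ C) :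
    HasIntegralPartAsymptotic
      (fun n => ((ArithmeticFunction.id : ArithmeticFunction ℂ) * g) n) := by
  refine ⟨summable_mainTerm hg, ?_⟩
  have hC : 0 ≤ C := (norm_nonneg _).trans (hg 1 le_rfl)
  set M := ∑' m, mainTerm (fun n => ((ArithmeticFunction.id : ArithmeticFunction ℂ) * g) n) m
  set Z := ∑' d : ℕ, 1 / (d : ℝ) ^ ((4 : ℝ) / 3) with hZ
  set Z2 := ∑' d : ℕ, 1 / (d : ℝ) ^ 2 with hZ2
  have hZ0 : 0 ≤ Z := tsum_nonneg fun d => by positivity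
  have hZ20 : 0 ≤ Z2 := tsum_nonneg fun d => by positivity
  refine IsBigO.of_bound (C * (480004 + 48000 * Z + 2 * Z2) + ‖M‖) ?_
  filter_upwards [eventually_ge_atTop (1 : ℝ), Real.tendsto_log_atTop.eventually_ge_atTop 1]
    with x hx hL
  have h1 := norm_integralPartSum_sub_le hg hx
  have hj := natLog_floor_add_one_le hL hx
  set L := Real.log x with hLdef
  set y := x ^ ((1 : ℝ) / 3) with hy
  have hy1 : 1 ≤ y := Real.one_le_rpow hx (by norm_num)
  have hyL : 1 ≤ y * L := one_le_mul_of_one_le_of_one_le hy1 hL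
  rw [Real.norm_eq_abs, abs_of_nonneg (by linarith : 0 ≤ y * L)]
  -- Replacing ⌊x⌋ by x in the main term costs at most the norm of the leading coefficient.
  have hfloor : ‖((⌊x⌋₊ : ℂ) - x) * M‖ ≤ ‖M‖ := by
    rw [norm_mul]
    refine mul_le_of_le_one_left (norm_nonneg _) ?_
    rw [show (⌊x⌋₊ : ℂ) - x = (((⌊x⌋₊ : ℝ) - x : ℝ) : ℂ) by push_cast; rfl, Complex.norm_real,
      Real.norm_eq_abs, abs_le]
    have := Nat.floor_le (by linarith : 0 ≤ x)
    have := Nat.lt_floor_add_one x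
    constructor <;> linarith
  have e : ∀ S : ℂ, S - x * M = (S - ⌊x⌋₊ * M) + ((⌊x⌋₊ : ℂ) - x) * M := fun S => by ring
  rw [e]
  refine (norm_add_le _ _).trans ((add_le_add h1 hfloor).trans ?_)
  have h2 : 240002 * y * (1 + L) + 16000 * y * (Nat.log 2 ⌊x⌋₊ + 1) * Z + 2 * Z2
      ≤ (480004 + 48000 * Z + 2 * Z2) * (y * L) := by
    have a1 : 240002 * y * (1 + L) ≤ 240002 * y * (L + L) := by gcongr
    have a2 : 16000 * y * (Nat.log 2 ⌊x⌋₊ + 1) * Z ≤ 16000 * y * (3 * L) * Z := by gcongr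
    have a3 : 2 * Z2 * 1 ≤ 2 * Z2 * (y * L) := by gcongr
    linarith
  calc C * _ + ‖M‖ ≤ C * ((480004 + 48000 * Z + 2 * Z2) * (y * L)) + ‖M‖ * (y * L) :=
        add_le_add (mul_le_mul_of_nonneg_left h2 hC) (le_mul_of_one_le_right (norm_nonneg _) hyL)
    _ = _ := by ring

/-! ### The four examples as convolutions with bounded functions -/

theorem totient_eq_id_mul_moebius (n : ℕ) :
    (Nat.totient n : ℂ) = ((ArithmeticFunction.id : ArithmeticFunction ℂ)
      * (ArithmeticFunction.moebius : ArithmeticFunction ℂ)) n := by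
  rcases Nat.eq_zero_or_pos n with rfl | hn
  · simp
  have h := (ArithmeticFunction.sum_eq_iff_sum_mul_moebius_eq (R := ℂ)
    (f := fun n => (Nat.totient n : ℂ)) (g := fun n => (n : ℂ))).1
    (fun n _ => by exact_mod_cast Nat.sum_totient n) n hn
  rw [← h, mul_comm (ArithmeticFunction.id : ArithmeticFunction ℂ), ArithmeticFunction.mul_apply]
  simp

theorem sigma_one_eq_id_mul_zeta (n : ℕ) :
    (ArithmeticFunction.sigma 1 n : ℂ) = ((ArithmeticFunction.id : ArithmeticFunction ℂ)
      * (ArithmeticFunction.zeta : ArithmeticFunction ℂ)) n := by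
  rw [ArithmeticFunction.coe_mul_zeta_apply, ArithmeticFunction.sigma_one_apply]
  simp

/-- The Liouville function as an arithmetic function with complex values. -/
noncomputable def liouvilleComplex : ArithmeticFunction ℂ :=
  ⟨fun n => if n = 0 then 0 else (-1) ^ ArithmeticFunction.cardFactors n, by simp⟩

theorem alternatingSigma_eq_id_mul (n : ℕ) :
    alternatingSigma n =
      ((ArithmeticFunction.id : ArithmeticFunction ℂ) * liouvilleComplex) n := by
  rw [alternatingSigma, ArithmeticFunction.mul_apply,
    ← Nat.sum_divisorsAntidiagonal
      (f := fun i j => (i : ℂ) * (-1) ^ ArithmeticFunction.cardFactors j)]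
  refine Finset.sum_congr rfl fun p hp => ?_
  have h : p.2 ≠ 0 := by
    obtain ⟨h, h0⟩ := Nat.mem_divisorsAntidiagonal.1 hp
    exact right_ne_zero_of_mul (h ▸ h0)
  simp [liouvilleComplex, h]

/-- The indicator of the squarefree numbers as an arithmetic function with complex values. -/
noncomputable def squarefreeIndicator : ArithmeticFunction ℂ :=
  ⟨fun n => if Squarefree n then 1 else 0, by simp⟩

theorem dedekindPsi_eq_id_mul (n : ℕ) :
    dedekindPsi n =
      ((ArithmeticFunction.id : ArithmeticFunction ℂ) * squarefreeIndicator) n := by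
  rcases eq_or_ne n 0 with rfl | hn
  · simp [dedekindPsi]
  have h : ((ArithmeticFunction.id : ArithmeticFunction ℂ) * squarefreeIndicator) n
      = ∑ d ∈ n.divisors with Squarefree d, (n : ℂ) * (1 / (d : ℂ)) := by
    rw [ArithmeticFunction.mul_apply, Finset.sum_filter, ← Nat.sum_divisorsAntidiagonal'
      (f := fun _ d => if Squarefree d then (n : ℂ) * (1 / (d : ℂ)) else 0)]
    refine Finset.sum_congr rfl fun p hp => ?_
    obtain ⟨h, h0⟩ := Nat.mem_divisorsAntidiagonal.1 hp
    have h2 : (p.2 : ℂ) ≠ 0 := by exact_mod_cast right_ne_zero_of_mul (h ▸ h0)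
    rw [← h]
    simp [squarefreeIndicator, h2]
  -- Squarefree divisors correspond to sets of prime factors, so the sum is the expansion of ∏ (1 +
  -- 1/p).
  rw [h, Nat.sum_divisors_filter_squarefree hn, dedekindPsi, Finset.prod_one_add, Finset.mul_sum]
  rw [show (UniqueFactorizationMonoid.normalizedFactors n).toFinset = n.primeFactors by
    rw [Nat.factors_eq]; rfl]
  refine Finset.sum_congr rfl fun s _ => ?_
  rw [show s.val.prod = ∏ p ∈ s, p by rw [Finset.prod, Multiset.map_id']]
  simp

theorem theorem1 :
    (∀ f g : ArithmeticFunction ℂ,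
      f = (ArithmeticFunction.id : ArithmeticFunction ℂ) * g →
      (∃ C : ℝ, ∀ n : ℕ, 1 ≤ n → ‖g n‖ ≤ C) →
      HasIntegralPartAsymptotic (fun n => f n)) ∧
    HasIntegralPartAsymptotic (fun n => (Nat.totient n : ℂ)) ∧
    HasIntegralPartAsymptotic dedekindPsi ∧
    HasIntegralPartAsymptotic (fun n => (ArithmeticFunction.sigma 1 n : ℂ)) ∧
    HasIntegralPartAsymptotic alternatingSigma := by
  refine ⟨?_, ?_, ?_, ?_, ?_⟩
  · rintro f g rfl ⟨C, hC⟩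
    exact hasIntegralPartAsymptotic_id_mul hC
  · rw [funext totient_eq_id_mul_moebius]
    refine hasIntegralPartAsymptotic_id_mul (C := 1) fun n _ => ?_
    rw [ArithmeticFunction.intCoe_apply, Complex.norm_intCast]
    exact_mod_cast ArithmeticFunction.abs_moebius_le_one
  · rw [funext dedekindPsi_eq_id_mul]
    refine hasIntegralPartAsymptotic_id_mul (C := 1) fun n _ => ?_
    by_cases h : Squarefree n <;> simp [squarefreeIndicator, h]
  · rw [funext sigma_one_eq_id_mul_zeta]
    refine hasIntegralPartAsymptotic_id_mul (C := 1) fun n hn => ?_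
    simp [ArithmeticFunction.natCoe_apply, ArithmeticFunction.zeta_apply_ne (by omega : n ≠ 0)]
  · rw [funext alternatingSigma_eq_id_mul]
    refine hasIntegralPartAsymptotic_id_mul (C := 1) fun n hn => ?_
    have h0 : n ≠ 0 := by omega
    simp [liouvilleComplex, h0]
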